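/- Let $x=(x_1,\dots,x_n)$ be unknowns and $y=(y_1,\dots,y_t)$ parameters, and let $f=(f_1,\dots,f_e)$ be polynomials in $\mathbb{Q}[y][x]$. For $p\in\mathbb{Q}[y][x]$ let $\deg p$ be its total degree in $(x,y)$ and $\deg_x p$ its degree in $x$. Put $\mathbb{K}=\mathbb{Q}(y)$ and $d=\max_{1\le i\le e}\deg f_i$. Assume the following. (1) There is a nonempty Zariski open set $\mathcal{O}\subseteq\mathbb{C}^t$ such that for every $\eta\in\mathcal{O}$ the set $\{x\in\mathbb{C}^n : f_1(\eta,x)=\dots=f_e(\eta,x)=0\}$ is nonempty and finite. (2) $f$ is an affine regular sequence in $\mathbb{K}[x]$: $e\le n$ and, writing $f_i^H$ for the homogeneous component of highest degree of $f_i$ as a polynomial in $x$ over $\mathbb{K}$, $f_i^H$ is not a zero-divisor in $\mathbb{K}[x]/\langle f_1^H,\dots,f_{i-1}^H\rangle$ for $1\le i\le e$. (3) Let $\mathscr{G}$ be the reduced Gröbner basis of the ideal $\langle f\rangle\subset\mathbb{Q}[x,y]$ for the elimination order $\mathrm{grevlex}(x)\succ\mathrm{grevlex}(y)$, where $x_1\succ\dots\succ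 x_n$ and $y_1\succ\dots\succ y_t$ (the $x$-parts of monomials are compared first, and ties are broken by the $y$-parts). Then $\deg p=\deg_x p$ for every $p\in\mathscr{G}$. Let $\mathscr{B}$ be the set of monomials in $x$ that are not divisible by the leading monomial, for $\mathrm{grevlex}(x)$, of any element of $\mathscr{G}$ regarded in $\mathbb{K}[x]$. For $g\in\mathbb{Q}[y][x]$ let $\mathcal{H}_g=(\mathrm{tr}(L_{g b b'}))_{b,b'\in\mathscr{B}}$ be the parametric Hermite matrix, where $L_q$ is the multiplication by $q$ on the $\mathbb{K}$-vector space $\mathbb{K}[x]/\langle f\rangle_{\mathbb{K}}$. Then, for every $g\in\mathbb{Q}[y][x]$, every minor of $\mathcal{H}_g$ is a polynomial in $\mathbb{Q}[y]$ of degree at most $(\deg g+n(d-1))\,d^n$. (Here the zero polynomial is given degree $0$.) -/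

import Mathlib

open MvPolynomial

/-- The graded reverse lexicographic ordering on the monomials in `x_0 ≻ x_1 ≻ ⋯ ≻ x_{n-1}`.
An exponent vector `a` is encoded by its tuple of partial sums
`(a_0 + ⋯ + a_{n-1}, a_0 + ⋯ + a_{n-2}, …, a_0)`, and such tuples are compared
lexicographically; `grevlex_lt_iff` below gives the usual description. -/
def grevlexKey (n : ℕ) : (Fin n →₀ ℕ) →+ Lex (Fin n → ℕ) where
  toFun a := toLex fun k => ∑ i with i ≤ k.rev, a i
  map_zero' := by
    apply toLex.symm.injective
    funext k
    change ∑ i with i ≤ k.rev, (0 : Fin n →₀ ℕ) i = 0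
    simp
  map_add' a b := by
    apply toLex.symm.injective
    funext k
    change ∑ i with i ≤ k.rev, (a i + b i)
      = ∑ i with i ≤ k.rev, a i + ∑ i with i ≤ k.rev, b i
    exact Finset.sum_add_distrib

theorem grevlexKey_sum_eq {n : ℕ} (a : Fin n →₀ ℕ) (k : Fin n) :
    ∑ i with i ≤ k, a i = a k + ∑ i with i < k, a i := by
  have h : (Finset.univ.filter fun i : Fin n => i ≤ k)
      = insert k (Finset.univ.filter fun i : Fin n => i < k) := by
    ext i
    simp [le_iff_eq_or_lt]
  rw [h, Finset.sum_insert (by simp)]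

theorem grevlexKey_injective (n : ℕ) : Function.Injective (grevlexKey n) := by
  intro a b h
  have h' : ∀ k : Fin n, ∑ i with i ≤ k, a i = ∑ i with i ≤ k, b i := by
    intro k
    have := congrFun (congrArg ofLex h) k.rev
    simpa [grevlexKey] using this
  have key : ∀ k : Fin n, a k = b k := by
    intro k
    induction k using WellFoundedLT.induction with
    | ind k ih =>
      have h1 := h' k
      rw [grevlexKey_sum_eq, grevlexKey_sum_eq] at h1
      have h2 : ∑ i with i < k, a i = ∑ i with i < k, b i :=
        Finset.sum_congr rfl fun i hi => ih i (by simpa using hi)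
      omega
  exact Finsupp.ext key

/-- The graded reverse lexicographic monomial order on `Fin n` with `x_0 ≻ ⋯ ≻ x_{n-1}`. -/
noncomputable def grevlex (n : ℕ) : MonomialOrder (Fin n) where
  syn := AddMonoidHom.mrange (grevlexKey n)
  addCommMonoidSyn := (AddMonoidHom.mrange (grevlexKey n)).toAddCommMonoid
  toSyn :=
    { Equiv.ofBijective (grevlexKey n).mrangeRestrict
        ⟨fun _ _ h => grevlexKey_injective n (congrArg Subtype.val h),
          (grevlexKey n).mrangeRestrict_surjective⟩ with
      map_add' := fun a b => (grevlexKey n).mrangeRestrict.map_add a b }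
  toSyn_monotone := by
    intro a b h
    change (grevlexKey n a) ≤ (grevlexKey n b)
    exact Pi.toLex_monotone fun k => Finset.sum_le_sum fun i _ => h i

theorem grevlex_lt_of {n : ℕ} {a b : Fin n →₀ ℕ}
    (h : a.degree < b.degree ∨
      (a.degree = b.degree ∧ ∃ i, b i < a i ∧ ∀ j, i < j → a j = b j)) :
    (grevlex n).toSyn a < (grevlex n).toSyn b := by
  change grevlexKey n a < grevlexKey n b
  have split : ∀ (c : Fin n →₀ ℕ) (k : Fin n),
      c.degree = (∑ i with i ≤ k, c i) + ∑ i with k < i, c i := by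
    intro c k
    rw [Finsupp.degree_eq_sum, ← Finset.sum_filter_add_sum_filter_not Finset.univ (fun i => i ≤ k)]
    simp
  rcases h with h | ⟨h, i, hi, hj⟩
  · have hn : n ≠ 0 := by
      rintro rfl
      simp [Finsupp.degree_eq_sum] at h
    obtain ⟨m, rfl⟩ := Nat.exists_eq_succ_of_ne_zero hn
    refine ⟨0, fun j hj => absurd hj (by simp), ?_⟩
    have hlast : ∀ c : Fin (m + 1) →₀ ℕ,
        ∑ i with i ≤ (0 : Fin (m + 1)).rev, c i = c.degree := by
      intro c
      rw [Finsupp.degree_eq_sum]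
      refine Finset.sum_congr ?_ fun _ _ => rfl
      ext i
      simp [Fin.le_last]
    change ∑ i with i ≤ (0 : Fin (m + 1)).rev, a i < ∑ i with i ≤ (0 : Fin (m + 1)).rev, b i
    rw [hlast, hlast]
    exact h
  · have heq : ∀ k, i ≤ k → ∑ l with l ≤ k, a l = ∑ l with l ≤ k, b l := by
      intro k hk
      have h1 := split a k
      have h2 := split b k
      have h3 : ∑ l with k < l, a l = ∑ l with k < l, b l :=
        Finset.sum_congr rfl fun l hl => hj l (lt_of_le_of_lt hk (by simpa using hl))
      omega
    have h1 := heq i le_rfl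
    rw [grevlexKey_sum_eq, grevlexKey_sum_eq] at h1
    have h2 : ∑ l with l < i, a l < ∑ l with l < i, b l := by omega
    have hi0 : 0 < i.val := by
      rcases Nat.eq_zero_or_pos i.val with h0 | h0
      · have : (Finset.univ.filter fun l : Fin n => l < i) = ∅ := by
          ext l
          simp [Fin.lt_def, h0]
        rw [this] at h2
        simp at h2
      · exact h0
    let p : Fin n := ⟨i.val - 1, by omega⟩
    have hp : (Finset.univ.filter fun l : Fin n => l < i)
        = Finset.univ.filter fun l : Fin n => l ≤ p := by
      ext l
      simp only [Finset.mem_filter, Finset.mem_univ, true_and, Fin.lt_def, Fin.le_def, p]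
      omega
    rw [hp] at h2
    refine ⟨p.rev, fun j hj' => ?_, ?_⟩
    · refine heq j.rev ?_
      simp only [Fin.lt_def, Fin.le_def, Fin.val_rev, p] at hj' ⊢
      omega
    · change ∑ l with l ≤ p.rev.rev, a l < ∑ l with l ≤ p.rev.rev, b l
      rw [Fin.rev_rev]
      exact h2

/-- `a ≺ b` for `grevlex` iff `deg a < deg b`, or the degrees agree and the last exponent in
which they differ is larger in `a`. -/
theorem grevlex_lt_iff {n : ℕ} (a b : Fin n →₀ ℕ) :
    (grevlex n).toSyn a < (grevlex n).toSyn b ↔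
      a.degree < b.degree ∨
        (a.degree = b.degree ∧ ∃ i, b i < a i ∧ ∀ j, i < j → a j = b j) := by
  refine ⟨fun hlt => ?_, grevlex_lt_of⟩
  rcases lt_trichotomy a.degree b.degree with h | h | h
  · exact Or.inl h
  · refine Or.inr ⟨h, ?_⟩
    have hne : (Finset.univ.filter fun i => a i ≠ b i).Nonempty := by
      by_contra hc
      rw [Finset.not_nonempty_iff_eq_empty, Finset.filter_eq_empty_iff] at hc
      have hab : a = b := Finsupp.ext fun i => not_not.mp (hc (Finset.mem_univ i))
      exact absurd hlt (by rw [hab]; exact lt_irrefl _)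
    obtain ⟨i, hi, hmax⟩ := Finset.exists_max_image _ id hne
    have hj : ∀ j, i < j → a j = b j := by
      intro j hij
      by_contra hc
      exact absurd (hmax j (by simpa using hc)) (not_le.mpr hij)
    refine ⟨i, ?_, hj⟩
    rcases lt_or_gt_of_ne (Finset.mem_filter.mp hi).2 with h' | h'
    · exact absurd (grevlex_lt_of (a := b) (b := a)
        (Or.inr ⟨h.symm, i, h', fun j hij => (hj j hij).symm⟩)) (not_lt.mpr hlt.le)
    · exact h'
  · exact absurd (grevlex_lt_of (a := b) (b := a) (Or.inl h)) (not_lt.mpr hlt.le)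

/-- The block (elimination) order: compare the `inl`-variables with `m₁`, and break ties by
comparing the `inr`-variables with `m₂`. -/
noncomputable def elimOrder {σ τ : Type*} (m₁ : MonomialOrder σ) (m₂ : MonomialOrder τ) :
    MonomialOrder (σ ⊕ τ) where
  syn := m₁.syn ×ₗ m₂.syn
  toSyn := (Finsupp.sumFinsuppAddEquivProdFinsupp.trans
    (AddEquiv.prodCongr m₁.toSyn m₂.toSyn)).trans (toLexAddEquiv _)
  toSyn_monotone := by
    intro a b h
    apply Prod.Lex.toLex_mono
    refine ⟨m₁.toSyn_monotone fun i => ?_, m₂.toSyn_monotone fun i => ?_⟩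
    · simpa using h (Sum.inl i)
    · simpa using h (Sum.inr i)

/-- The ring `ℚ[y][x] = ℚ[x, y]` in the unknowns `x_0, …, x_{n-1}` (the variables `inl i`) and
the parameters `y_0, …, y_{t-1}` (the variables `inr j`). `totalDegree` is the total degree in
all the variables. -/
abbrev ParamPoly (t n : ℕ) : Type := MvPolynomial (Fin n ⊕ Fin t) ℚ

/-- The field `ℚ(y)`. -/
abbrev ParamField (t : ℕ) : Type := FractionRing (MvPolynomial (Fin t) ℚ)

/-- The degree with respect to the unknowns `x`. -/
noncomputable def degX {t n : ℕ} (p : ParamPoly t n) : ℕ :=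
  (sumAlgEquiv ℚ (Fin n) (Fin t) p).totalDegree

/-- The inclusion `ℚ[y][x] ⊆ ℚ(y)[x]`. -/
noncomputable def toKx (t n : ℕ) : ParamPoly t n →+* MvPolynomial (Fin n) (ParamField t) :=
  (MvPolynomial.map (algebraMap (MvPolynomial (Fin t) ℚ) (ParamField t))).comp
    (sumAlgEquiv ℚ (Fin n) (Fin t)).toRingEquiv.toRingHom

/-- The complex solutions `x` of the system specialized at `y = η`. -/
def paramFiber {t n e : ℕ} (f : Fin e → ParamPoly t n) (η : Fin t → ℂ) : Set (Fin n → ℂ) :=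
  {x | ∀ i, aeval (Sum.elim x η) (f i) = 0}

/-- Over a nonempty Zariski open set of parameters in `ℂ^t`, the specialized system has a nonempty
and finite set of complex solutions. -/
def IsGenericallyFinite {t n e : ℕ} (f : Fin e → ParamPoly t n) : Prop :=
  ∃ O : Set (Fin t → ℂ), O.Nonempty ∧
    (∃ J : Ideal (MvPolynomial (Fin t) ℂ), O = (zeroLocus ℂ J)ᶜ) ∧
    ∀ η ∈ O, (paramFiber f η).Nonempty ∧ (paramFiber f η).Finite

/-- A homogeneous regular sequence in `K[x_0, …, x_{n-1}]`: at most `n` homogeneous polynomials,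
each a non-zero-divisor modulo the previous ones. -/
def IsHomogeneousRegularSeq {K : Type*} [Field K] {n e : ℕ}
    (h : Fin e → MvPolynomial (Fin n) K) : Prop :=
  e ≤ n ∧ (∀ i, ∃ k, (h i).IsHomogeneous k) ∧
    RingTheory.Sequence.IsWeaklyRegular (MvPolynomial (Fin n) K) (List.ofFn h)

/-- An affine regular sequence: the homogeneous components of highest degree form a homogeneous
regular sequence. -/
def IsAffineRegularSeq {K : Type*} [Field K] {n e : ℕ}
    (h : Fin e → MvPolynomial (Fin n) K) : Prop :=
  IsHomogeneousRegularSeq fun i => homogeneousComponent (h i).totalDegree (h i)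

/-- `G` is the reduced Gröbner basis of `I` for the monomial order `m`: monic elements of `I`,
whose leading monomials generate the leading monomial ideal of `I`, and such that no monomial of
an element of `G` is divisible by the leading monomial of another element of `G`. -/
structure IsReducedGroebnerBasis {σ K : Type*} [Field K] (m : MonomialOrder σ)
    (I : Ideal (MvPolynomial σ K)) (G : Set (MvPolynomial σ K)) : Prop where
  subset : G ⊆ I
  monic : ∀ p ∈ G, m.Monic p
  exists_degree_le : ∀ q ∈ I, q ≠ 0 → ∃ p ∈ G, m.degree p ≤ m.degree q
  reduced : ∀ p ∈ G, ∀ p' ∈ G, p' ≠ p → ∀ a ∈ p.support, ¬ m.degree p' ≤ a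

/-- The exponents of the monomials in `x` that are divisible by no leading monomial, for
`grevlex(x)`, of an element of `G` seen in `ℚ(y)[x]`. -/
def standardMonomials {t n : ℕ} (G : Set (ParamPoly t n)) : Set (Fin n →₀ ℕ) :=
  {b | ∀ p ∈ G, ¬ (grevlex n).degree (toKx t n p) ≤ b}

/-- The quotient ring `ℚ(y)[x] / ⟨f⟩`. -/
abbrev ParamQuotient {t n e : ℕ} (f : Fin e → ParamPoly t n) : Type :=
  MvPolynomial (Fin n) (ParamField t) ⧸ Ideal.span (Set.range fun i => toKx t n (f i))

/-- The parametric Hermite matrix: its entry at the standard monomials `b`, `b'` is the trace of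
the multiplication by `g * b * b'` on `ℚ(y)[x] / ⟨f⟩`. -/
noncomputable def hermiteMatrix {t n e : ℕ} (f : Fin e → ParamPoly t n)
    (G : Set (ParamPoly t n)) (g : ParamPoly t n) :
    Matrix (standardMonomials G) (standardMonomials G) (ParamField t) :=
  Matrix.of fun b b' =>
    LinearMap.trace (ParamField t) (ParamQuotient f)
      (LinearMap.mulLeft (ParamField t)
        (Ideal.Quotient.mk (Ideal.span (Set.range fun i => toKx t n (f i)))
          (toKx t n g * monomial b.1 1 * monomial b'.1 1)))

/-! Two facts carry the bound: entry `(b, b')` of the Hermite matrix is a polynomial of degree at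
most `deg g + deg b + deg b'`, and the degrees of the standard monomials have an explicitly
controlled sum.

Entries. Grevlex compares degrees first, so `deg p = deg_x p` forces the leading monomial of `p ∈ G`
to be free of `y` and of degree `deg p`. Division by `G` then needs no denominators and never raises
the total degree (`exists_normalForm`). Hence the standard monomials form a basis of the quotient
over `ℚ[y]`, and over `ℚ(y)` after localization. The trace of multiplication by `q` is the sum over
`b` of the coefficient of `b` in the normal form of `q * b`; each coefficient has degree at most
`deg q` (`exists_trace_eq_algebraMap`). By the Leibniz formula a minor has degree at most the sum of
`deg g + 2 deg b` over all `b`.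

Sum of degrees. Let `k i` be the `x`-degree of `f i`. Because reduction respects degree, the affine
Hilbert function of `⟨f⟩` counts standard monomials by degree. The regular sequence computes the
same function, giving `(∑ X ^ deg b) * (1 - X) ^ n = ∏ (1 - X ^ k i)`
(`IsGradedMonomialBasis.sum_X_pow_mul`). If every `k i` is positive, this forces `e = n`, and the
value and derivative at `1` yield `|B| = ∏ k i` and `2 ∑ deg b = (∏ k i) * ∑ (k i - 1)`; now use `k
i ≤ d`. If some `k i` is zero, there are no standard monomials.

Finiteness of the set of standard monomials comes from specializing the free `ℚ[y]`-module at a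
parameter with finite fibre and applying the Nullstellensatz. -/

/-! ### Splitting exponents into `x`- and `y`-parts. -/

section SumExponents

variable {σ τ : Type*}

/-- The exponents of the `inl`-variables. -/
noncomputable def xPart : (σ ⊕ τ →₀ ℕ) →+ (σ →₀ ℕ) :=
  (AddMonoidHom.fst _ _).comp Finsupp.sumFinsuppAddEquivProdFinsupp.toAddMonoidHom

/-- The exponents of the `inr`-variables. -/
noncomputable def yPart : (σ ⊕ τ →₀ ℕ) →+ (τ →₀ ℕ) :=
  (AddMonoidHom.snd _ _).comp Finsupp.sumFinsuppAddEquivProdFinsupp.toAddMonoidHom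

@[simp] theorem xPart_apply (u : σ ⊕ τ →₀ ℕ) (i : σ) : xPart u i = u (Sum.inl i) := rfl

@[simp] theorem yPart_apply (u : σ ⊕ τ →₀ ℕ) (j : τ) : yPart u j = u (Sum.inr j) := rfl

@[simp] theorem xPart_sumElim (a : σ →₀ ℕ) (c : τ →₀ ℕ) : xPart (Finsupp.sumElim a c) = a := by
  ext; simp

@[simp] theorem yPart_sumElim (a : σ →₀ ℕ) (c : τ →₀ ℕ) : yPart (Finsupp.sumElim a c) = c := by
  ext; simp

@[simp] theorem sumElim_xPart_yPart (u : σ ⊕ τ →₀ ℕ) :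
    Finsupp.sumElim (xPart u) (yPart u) = u := by
  ext i; cases i <;> simp

theorem degree_xPart_add_degree_yPart [Fintype σ] [Fintype τ] (u : σ ⊕ τ →₀ ℕ) :
    (xPart u).degree + (yPart u).degree = u.degree := by
  simp [Finsupp.degree_eq_sum]

theorem sumAlgEquiv_monomial {R : Type*} [CommSemiring R] (u : σ ⊕ τ →₀ ℕ) (r : R) :
    sumAlgEquiv R σ τ (monomial u r) = monomial (xPart u) (monomial (yPart u) r) := by
  simp [sumAlgEquiv, monomial]
  rfl

theorem coeff_coeff_sumAlgEquiv {R : Type*} [CommSemiring R] (p : MvPolynomial (σ ⊕ τ) R)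
    (a : σ →₀ ℕ) (c : τ →₀ ℕ) :
    coeff c (coeff a (sumAlgEquiv R σ τ p)) = coeff (Finsupp.sumElim a c) p := by
  classical
  induction p using MvPolynomial.induction_on' with
  | monomial u r =>
    rw [sumAlgEquiv_monomial, coeff_monomial, coeff_monomial]
    by_cases hu : u = Finsupp.sumElim a c
    · subst hu; simp
    · rw [if_neg hu]
      split_ifs with h1
      · rw [coeff_monomial, if_neg]
        intro h2
        exact hu (by rw [← h1, ← h2, sumElim_xPart_yPart])
      · simp
  | add p q hp hq => simp [hp, hq]

theorem xPart_mem_support_sumAlgEquiv {R : Type*} [CommSemiring R]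
    {p : MvPolynomial (σ ⊕ τ) R} {u : σ ⊕ τ →₀ ℕ} (hu : u ∈ p.support) :
    xPart u ∈ (sumAlgEquiv R σ τ p).support := by
  rw [mem_support_iff] at hu ⊢
  intro h
  apply hu
  rw [← sumElim_xPart_yPart u, ← coeff_coeff_sumAlgEquiv, h, coeff_zero]

theorem exists_mem_support_of_mem_support_sumAlgEquiv {R : Type*} [CommSemiring R]
    {p : MvPolynomial (σ ⊕ τ) R} {a : σ →₀ ℕ} (ha : a ∈ (sumAlgEquiv R σ τ p).support) :
    ∃ u ∈ p.support, xPart u = a := by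
  rw [mem_support_iff, ne_zero_iff] at ha
  obtain ⟨c, hc⟩ := ha
  rw [coeff_coeff_sumAlgEquiv] at hc
  exact ⟨Finsupp.sumElim a c, mem_support_iff.mpr hc, xPart_sumElim a c⟩

theorem totalDegree_le_iff_forall_degree_le {R : Type*} [CommSemiring R] {p : MvPolynomial σ R}
    {N : ℕ} : p.totalDegree ≤ N ↔ ∀ u ∈ p.support, u.degree ≤ N :=
  Finset.sup_le_iff

theorem degree_le_totalDegree {R : Type*} [CommSemiring R] {p : MvPolynomial σ R}
    {u : σ →₀ ℕ} (hu : u ∈ p.support) : u.degree ≤ p.totalDegree :=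
  le_totalDegree hu

theorem totalDegree_sumAlgEquiv_le [Fintype σ] [Fintype τ] {R : Type*} [CommSemiring R]
    (p : MvPolynomial (σ ⊕ τ) R) : (sumAlgEquiv R σ τ p).totalDegree ≤ p.totalDegree := by
  rw [totalDegree_le_iff_forall_degree_le]
  intro a ha
  obtain ⟨u, hu, rfl⟩ := exists_mem_support_of_mem_support_sumAlgEquiv ha
  have := degree_xPart_add_degree_yPart u
  have := degree_le_totalDegree hu
  omega

theorem totalDegree_coeff_sumAlgEquiv_add_le [Fintype σ] [Fintype τ] {R : Type*}
    [CommSemiring R] (p : MvPolynomial (σ ⊕ τ) R) {a : σ →₀ ℕ}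
    (ha : coeff a (sumAlgEquiv R σ τ p) ≠ 0) :
    (coeff a (sumAlgEquiv R σ τ p)).totalDegree + a.degree ≤ p.totalDegree := by
  have key : ∀ c ∈ (coeff a (sumAlgEquiv R σ τ p)).support,
      c.degree + a.degree ≤ p.totalDegree := by
    intro c hc
    rw [mem_support_iff, coeff_coeff_sumAlgEquiv] at hc
    have h1 := degree_le_totalDegree (mem_support_iff.mpr hc)
    have h2 := degree_xPart_add_degree_yPart (Finsupp.sumElim a c)
    rw [xPart_sumElim, yPart_sumElim] at h2
    omega
  have h0 : a.degree ≤ p.totalDegree := by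
    obtain ⟨c, hc⟩ := ne_zero_iff.mp ha
    have := key c (mem_support_iff.mpr hc)
    omega
  have : (coeff a (sumAlgEquiv R σ τ p)).totalDegree ≤ p.totalDegree - a.degree :=
    totalDegree_le_iff_forall_degree_le.mpr fun c hc => by have := key c hc; omega
  omega

theorem elimOrder_toSyn_apply (m₁ : MonomialOrder σ) (m₂ : MonomialOrder τ) (u : σ ⊕ τ →₀ ℕ) :
    (elimOrder m₁ m₂).toSyn u = toLex (m₁.toSyn (xPart u), m₂.toSyn (yPart u)) := rfl

theorem toSyn_xPart_le_of_elimOrder_le {m₁ : MonomialOrder σ} {m₂ : MonomialOrder τ}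
    {u v : σ ⊕ τ →₀ ℕ} (h : (elimOrder m₁ m₂).toSyn u ≤ (elimOrder m₁ m₂).toSyn v) :
    m₁.toSyn (xPart u) ≤ m₁.toSyn (xPart v) := by
  rw [elimOrder_toSyn_apply, elimOrder_toSyn_apply] at h
  rcases Prod.Lex.toLex_le_toLex.mp h with h | h
  · exact h.le
  · exact h.1.le

theorem degree_sumAlgEquiv_eq_xPart (m₁ : MonomialOrder σ) (m₂ : MonomialOrder τ) {R : Type*}
    [CommSemiring R] {p : MvPolynomial (σ ⊕ τ) R} (hp : p ≠ 0) :
    m₁.degree (sumAlgEquiv R σ τ p) = xPart ((elimOrder m₁ m₂).degree p) := by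
  apply m₁.toSyn.injective
  apply le_antisymm
  · rw [MonomialOrder.degree_le_iff]
    intro a ha
    obtain ⟨u, hu, rfl⟩ := exists_mem_support_of_mem_support_sumAlgEquiv ha
    exact toSyn_xPart_le_of_elimOrder_le ((elimOrder m₁ m₂).le_degree hu)
  · exact m₁.le_degree
      (xPart_mem_support_sumAlgEquiv ((elimOrder m₁ m₂).degree_mem_support hp))

theorem degree_map_of_injective (m : MonomialOrder σ) {R S : Type*} [CommSemiring R]
    [CommSemiring S] {φ : R →+* S} (hφ : Function.Injective φ) (p : MvPolynomial σ R) :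
    m.degree (map φ p) = m.degree p := by
  simp only [MonomialOrder.degree, support_map_of_injective p hφ]

end SumExponents

/-! ### Division by `G` without denominators or growth of degree. -/

section NormalForm

variable {t n : ℕ}

theorem toKx_apply (p : ParamPoly t n) :
    toKx t n p = map (algebraMap (MvPolynomial (Fin t) ℚ) (ParamField t))
      (sumAlgEquiv ℚ (Fin n) (Fin t) p) := rfl

theorem degree_toKx {p : ParamPoly t n} (hp : p ≠ 0) :
    (grevlex n).degree (toKx t n p) = xPart ((elimOrder (grevlex n) (grevlex t)).degree p) := by
  rw [toKx_apply, degree_map_of_injective _ (IsFractionRing.injective _ _),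
    degree_sumAlgEquiv_eq_xPart _ _ hp]

theorem degree_le_of_grevlex_le {a b : Fin n →₀ ℕ}
    (h : (grevlex n).toSyn a ≤ (grevlex n).toSyn b) : a.degree ≤ b.degree := by
  by_contra! hlt
  exact absurd (grevlex_lt_of (Or.inl hlt)) (not_lt.mpr h)

/-- The `x`-part of the leading monomial already has degree at least `deg_x p`, while the whole
monomial has degree at most `deg p`; equality leaves no room for a `y`-exponent. -/
theorem degree_elimOrder_of_totalDegree_eq_degX {p : ParamPoly t n} (hp : p ≠ 0)
    (h : p.totalDegree = degX p) :
    yPart ((elimOrder (grevlex n) (grevlex t)).degree p) = 0 ∧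
      ((elimOrder (grevlex n) (grevlex t)).degree p).degree = p.totalDegree := by
  set D := (elimOrder (grevlex n) (grevlex t)).degree p
  have h1 : p.totalDegree ≤ (xPart D).degree := by
    rw [h, degX, totalDegree_le_iff_forall_degree_le]
    intro a ha
    obtain ⟨u, hu, rfl⟩ := exists_mem_support_of_mem_support_sumAlgEquiv ha
    exact degree_le_of_grevlex_le (toSyn_xPart_le_of_elimOrder_le
      ((elimOrder (grevlex n) (grevlex t)).le_degree hu))
  have h2 : D.degree ≤ p.totalDegree :=
    degree_le_totalDegree ((elimOrder (grevlex n) (grevlex t)).degree_mem_support hp)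
  have h3 := degree_xPart_add_degree_yPart D
  refine ⟨(Finsupp.degree_eq_zero_iff _).mp (by omega), by omega⟩

variable {I : Ideal (ParamPoly t n)} {G : Set (ParamPoly t n)}

/-- One division step, iterated by well-founded induction on the monomial order. A leading monomial
free of `y` divides `u` once it divides the `x`-part of `u`, and it has the largest total degree in
its polynomial, so the bound `N` survives. -/
theorem monomial_mem_restrictSupport_sup
    (hG : IsReducedGroebnerBasis (elimOrder (grevlex n) (grevlex t)) I G)
    (hdeg : ∀ p ∈ G, p.totalDegree = degX p) {N : ℕ} (u : Fin n ⊕ Fin t →₀ ℕ)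
    (hu : u.degree ≤ N) :
    monomial u (1 : ℚ) ∈
      restrictSupport ℚ {v | v.degree ≤ N ∧ xPart v ∈ standardMonomials G} ⊔
        I.restrictScalars ℚ := by
  set m := elimOrder (grevlex n) (grevlex t)
  set V := restrictSupport ℚ {v | v.degree ≤ N ∧ xPart v ∈ standardMonomials G} ⊔
        I.restrictScalars ℚ
  induction hw : m.toSyn u using WellFoundedLT.induction generalizing u with
  | ind w ih =>
  subst hw
  by_cases hS : xPart u ∈ standardMonomials G
  · refine Submodule.mem_sup_left ?_
    rw [monomial_mem_restrictSupport]
    exact Or.inl ⟨hu, hS⟩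
  · obtain ⟨p, hpG, hpu⟩ : ∃ p ∈ G, (grevlex n).degree (toKx t n p) ≤ xPart u := by
      simpa [standardMonomials] using hS
    have hp0 : p ≠ 0 := (hG.monic p hpG).ne_zero
    obtain ⟨hy, hD⟩ := degree_elimOrder_of_totalDegree_eq_degX hp0 (hdeg p hpG)
    rw [degree_toKx hp0] at hpu
    have hle : m.degree p ≤ u := by
      intro i
      rcases i with i | j
      · exact hpu i
      · have : (m.degree p) (Sum.inr j) = 0 := DFunLike.congr_fun hy j
        rw [this]
        exact Nat.zero_le _
    obtain ⟨w, rfl⟩ := exists_add_of_le hle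
    -- The tail of the shifted divisor: monicity cancels the leading term, so the induction
    -- hypothesis applies to every remaining monomial.
    set q := monomial w (1 : ℚ) * p - monomial (m.degree p + w) 1 with hq
    have hqV : q ∈ V := by
      rw [q.as_sum]
      refine Submodule.sum_mem _ fun v hv => ?_
      have hv1 : coeff v q ≠ 0 := mem_support_iff.mp hv
      have hvne : v ≠ m.degree p + w := by
        rintro rfl
        apply hv1
        rw [hq, coeff_sub, add_comm, coeff_monomial_mul, coeff_monomial, if_pos rfl,
          (hG.monic p hpG).coeff_degree]
        simp
      have hv2 : coeff v (monomial w (1 : ℚ) * p) ≠ 0 := by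
        intro h0
        apply hv1
        rw [hq, coeff_sub, h0, coeff_monomial, if_neg (Ne.symm hvne), sub_zero]
      rw [coeff_monomial_mul'] at hv2
      have hwv : w ≤ v := by
        by_contra hc
        exact hv2 (if_neg hc)
      obtain ⟨z, rfl⟩ := exists_add_of_le hwv
      rw [if_pos hwv, one_mul, add_tsub_cancel_left] at hv2
      have hz := mem_support_iff.mpr hv2
      rw [← mul_one (coeff _ q), ← smul_eq_mul, ← smul_monomial]
      refine Submodule.smul_mem _ _ (ih _ ?_ (w + z) ?_ rfl)
      · rw [map_add, map_add, add_comm]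
        refine add_lt_add_left (lt_of_le_of_ne (m.le_degree hz) fun h => hvne ?_) _
        rw [m.toSyn.injective h, add_comm]
      · have := degree_le_totalDegree hz
        have hD' : (m.degree p).degree = p.totalDegree := hD
        rw [map_add] at hu ⊢
        omega
    have : monomial (m.degree p + w) (1 : ℚ) = monomial w 1 * p - q := by rw [hq]; ring
    rw [this]
    refine Submodule.sub_mem _ (Submodule.mem_sup_right ?_) hqV
    exact I.mul_mem_left _ (hG.subset hpG)

theorem exists_normalForm
    (hG : IsReducedGroebnerBasis (elimOrder (grevlex n) (grevlex t)) I G)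
    (hdeg : ∀ p ∈ G, p.totalDegree = degX p) (q : ParamPoly t n) :
    ∃ r, q - r ∈ I ∧ r.totalDegree ≤ q.totalDegree ∧
      ∀ a ∈ (sumAlgEquiv ℚ (Fin n) (Fin t) r).support, a ∈ standardMonomials G := by
  have hq : q ∈ restrictSupport ℚ {v | v.degree ≤ q.totalDegree ∧ xPart v ∈ standardMonomials G} ⊔
        I.restrictScalars ℚ := by
    rw [q.as_sum]
    refine Submodule.sum_mem _ fun v hv => ?_
    rw [← mul_one (coeff v q), ← smul_eq_mul, ← smul_monomial, ← q.as_sum]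
    exact Submodule.smul_mem _ _
      (monomial_mem_restrictSupport_sup hG hdeg v (degree_le_totalDegree hv))
  obtain ⟨r, hr, s, hs, hrs⟩ := Submodule.mem_sup.mp hq
  rw [mem_restrictSupport_iff] at hr
  refine ⟨r, ?_, totalDegree_le_iff_forall_degree_le.mpr fun u hu => (hr hu).1, fun a ha => ?_⟩
  · rw [← hrs, add_sub_cancel_left]
    exact hs
  · obtain ⟨u, hu, rfl⟩ := exists_mem_support_of_mem_support_sumAlgEquiv ha
    exact (hr hu).2

theorem eq_zero_of_mem_of_support_subset_standardMonomials
    (hG : IsReducedGroebnerBasis (elimOrder (grevlex n) (grevlex t)) I G)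
    {q : ParamPoly t n} (hq : q ∈ I)
    (hS : ∀ a ∈ (sumAlgEquiv ℚ (Fin n) (Fin t) q).support, a ∈ standardMonomials G) : q = 0 := by
  by_contra h0
  obtain ⟨p, hpG, hle⟩ := hG.exists_degree_le q hq h0
  have h1 := hS _ (xPart_mem_support_sumAlgEquiv
    ((elimOrder (grevlex n) (grevlex t)).degree_mem_support h0))
  refine h1 p hpG ?_
  rw [degree_toKx (hG.monic p hpG).ne_zero]
  exact fun i => hle (Sum.inl i)

end NormalForm

/-! ### The filtration by degree and top homogeneous components. -/

section DegLT

variable {σ K : Type*}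

/-- The polynomials all of whose monomials have degree less than `N`. -/
noncomputable def degLT (σ K : Type*) [CommSemiring K] (N : ℕ) : Submodule K (MvPolynomial σ K) :=
  restrictSupport K {u | u.degree < N}

theorem mem_degLT [CommSemiring K] {N : ℕ} {p : MvPolynomial σ K} :
    p ∈ degLT σ K N ↔ ∀ u ∈ p.support, u.degree < N := by
  rw [degLT, mem_restrictSupport_iff]
  rfl

variable [CommRing K]

theorem degLT_mono {M N : ℕ} (h : M ≤ N) : degLT σ K M ≤ degLT σ K N :=
  fun _ hp => mem_degLT.mpr fun u hu => (mem_degLT.mp hp u hu).trans_le h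

theorem eq_zero_of_mem_degLT_zero {p : MvPolynomial σ K} (hp : p ∈ degLT σ K 0) : p = 0 := by
  rw [← support_eq_empty, Finset.eq_empty_iff_forall_notMem]
  exact fun u hu => absurd (mem_degLT.mp hp u hu) (Nat.not_lt_zero _)

theorem mem_degLT_totalDegree_succ (p : MvPolynomial σ K) : p ∈ degLT σ K (p.totalDegree + 1) :=
  mem_degLT.mpr fun _ hu => Nat.lt_succ_of_le (degree_le_totalDegree hu)

theorem homogeneousComponent_mem_degLT (m : ℕ) (p : MvPolynomial σ K) :
    homogeneousComponent m p ∈ degLT σ K (m + 1) := by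
  refine mem_degLT.mpr fun u hu => ?_
  rw [mem_support_iff, coeff_homogeneousComponent] at hu
  split_ifs at hu with h
  · omega
  · exact absurd rfl hu

theorem homogeneousComponent_eq_zero_of_mem_degLT {m : ℕ} {p : MvPolynomial σ K}
    (hp : p ∈ degLT σ K m) : homogeneousComponent m p = 0 :=
  homogeneousComponent_eq_zero' _ _ fun u hu => (mem_degLT.mp hp u hu).ne

theorem mem_degLT_of_homogeneousComponent_eq_zero {m : ℕ} {p : MvPolynomial σ K}
    (hp : p ∈ degLT σ K (m + 1)) (h : homogeneousComponent m p = 0) : p ∈ degLT σ K m := by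
  refine mem_degLT.mpr fun u hu => ?_
  refine lt_of_le_of_ne (Nat.lt_succ_iff.mp (mem_degLT.mp hp u hu)) fun hm => ?_
  apply mem_support_iff.mp hu
  have := coeff_homogeneousComponent m p u
  rwa [if_pos hm, h, coeff_zero, eq_comm] at this

theorem sub_homogeneousComponent_mem_degLT {m : ℕ} {p : MvPolynomial σ K}
    (hp : p ∈ degLT σ K (m + 1)) : p - homogeneousComponent m p ∈ degLT σ K m := by
  apply mem_degLT_of_homogeneousComponent_eq_zero
    (Submodule.sub_mem _ hp (homogeneousComponent_mem_degLT m p))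
  rw [map_sub, homogeneousComponent_eq_self (homogeneousComponent_isHomogeneous m p), sub_self]

theorem mul_mem_degLT {N d : ℕ} {a f : MvPolynomial σ K} (ha : a ∈ degLT σ K N)
    (hf : f ∈ degLT σ K (d + 1)) : a * f ∈ degLT σ K (N + d) := by
  classical
  refine mem_degLT.mpr fun u hu => ?_
  obtain ⟨v, hv, w, hw, rfl⟩ := Finset.mem_add.mp (support_mul a f hu)
  have h1 := mem_degLT.mp ha v hv
  have h2 := mem_degLT.mp hf w hw
  rw [map_add]
  omega

/-- The strict inequality in `degLT` makes level `0` the zero space, so truncated subtraction is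
correct also when `d > N`. -/
theorem mul_mem_degLT_of_tsub {N d : ℕ} {a f : MvPolynomial σ K} (ha : a ∈ degLT σ K (N - d))
    (hf : f ∈ degLT σ K (d + 1)) : a * f ∈ degLT σ K N := by
  rcases le_total d N with h | h
  · have := mul_mem_degLT ha hf
    rwa [Nat.sub_add_cancel h] at this
  · rw [Nat.sub_eq_zero_of_le h] at ha
    rw [eq_zero_of_mem_degLT_zero ha, zero_mul]
    exact Submodule.zero_mem _

theorem homogeneousComponent_mul_of_mem_degLT {m d : ℕ} {a f : MvPolynomial σ K}
    (ha : a ∈ degLT σ K (m + 1)) (hf : f ∈ degLT σ K (d + 1)) :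
    homogeneousComponent (m + d) (a * f)
      = homogeneousComponent m a * homogeneousComponent d f := by
  have h1 := mul_mem_degLT (sub_homogeneousComponent_mem_degLT ha) hf
  have h2 := mul_mem_degLT (sub_homogeneousComponent_mem_degLT hf)
    (homogeneousComponent_mem_degLT m a)
  have h3 : a * f = (a - homogeneousComponent m a) * f
      + (f - homogeneousComponent d f) * homogeneousComponent m a
      + homogeneousComponent m a * homogeneousComponent d f := by ring
  rw [h3, map_add, map_add, homogeneousComponent_eq_zero_of_mem_degLT h1,
    homogeneousComponent_eq_zero_of_mem_degLT (by rwa [add_comm m d]), zero_add, zero_add]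
  exact homogeneousComponent_eq_self ((homogeneousComponent_isHomogeneous m a).mul
    (homogeneousComponent_isHomogeneous d f))

theorem homogeneousComponent_add_mul_of_isHomogeneous {d : ℕ} {c : MvPolynomial σ K}
    (hc : c.IsHomogeneous d) (m : ℕ) (b : MvPolynomial σ K) :
    homogeneousComponent (m + d) (b * c) = homogeneousComponent m b * c := by
  induction b using MvPolynomial.induction_on' with
  | monomial u r =>
    have h1 : (monomial u r).IsHomogeneous u.degree := isHomogeneous_monomial r rfl
    rw [homogeneousComponent_of_mem (h1.mul hc), homogeneousComponent_of_mem h1]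
    by_cases h : m = u.degree <;> simp [h]
  | add p q hp hq => simp only [add_mul, map_add, hp, hq]

theorem homogeneousComponent_mul_eq_zero_of_lt {d : ℕ} {c : MvPolynomial σ K}
    (hc : c.IsHomogeneous d) {m : ℕ} (hm : m < d) (b : MvPolynomial σ K) :
    homogeneousComponent m (b * c) = 0 := by
  induction b using MvPolynomial.induction_on' with
  | monomial u r =>
    have h1 : (monomial u r).IsHomogeneous u.degree := isHomogeneous_monomial r rfl
    rw [homogeneousComponent_of_mem (h1.mul hc), if_neg (by omega)]
  | add p q hp hq => simp only [add_mul, map_add, hp, hq, add_zero]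

end DegLT

/-! ### Leading forms of ideals generated by affine regular sequences. -/

section LeadingForms

variable {σ K : Type*} [CommRing K]

/-- `J` is the ideal of leading forms of `I`. -/
structure IsLeadingFormIdeal (I J : Ideal (MvPolynomial σ K)) : Prop where
  component_mem : ∀ m, ∀ h ∈ I, h ∈ degLT σ K (m + 1) → homogeneousComponent m h ∈ J
  exists_lift : ∀ c ∈ J, ∀ m, ∃ h ∈ I, h ∈ degLT σ K (m + 1) ∧
    homogeneousComponent m h = homogeneousComponent m c

theorem isLeadingFormIdeal_bot :
    IsLeadingFormIdeal (⊥ : Ideal (MvPolynomial σ K)) ⊥ where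
  component_mem m h hh _ := by rw [Ideal.mem_bot.mp hh, map_zero]; exact Ideal.zero_mem _
  exists_lift c hc m := ⟨0, Ideal.zero_mem _, Submodule.zero_mem _, by rw [Ideal.mem_bot.mp hc]⟩

namespace IsLeadingFormIdeal

variable {I J : Ideal (MvPolynomial σ K)} (hIJ : IsLeadingFormIdeal I J) {f : MvPolynomial σ K}
  {d : ℕ} (hf : f ∈ degLT σ K (d + 1))
  (hreg : ∀ a, a * homogeneousComponent d f ∈ J → a ∈ J)

include hIJ hf hreg in
-- When the top forms of `g` and `a * f` cancel, the product of the top forms of `a` and `f` lies in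
-- `J`. Regularity puts the form of `a` in `J`, and lifting it to `I` gives the correction that
-- lowers the degree of `a`.
theorem exists_sub_mem_degLT {m : ℕ} {g a : MvPolynomial σ K} (hg : g ∈ I)
    (ha : a ∈ degLT σ K (m + 1)) (hga : g + a * f ∈ degLT σ K (m + d)) :
    ∃ h ∈ I, a - h ∈ degLT σ K m := by
  have haf : a * f ∈ degLT σ K (m + d + 1) := by
    have := mul_mem_degLT ha hf
    rwa [show m + 1 + d = m + d + 1 by omega] at this
  have hg' : g ∈ degLT σ K (m + d + 1) := by
    have := Submodule.sub_mem _ (degLT_mono (Nat.le_succ _) hga) haf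
    rwa [add_sub_cancel_right] at this
  have h1 := hIJ.component_mem _ g hg hg'
  have h2 := homogeneousComponent_eq_zero_of_mem_degLT hga
  rw [map_add, homogeneousComponent_mul_of_mem_degLT ha hf, add_comm] at h2
  have h3 := hreg (homogeneousComponent m a) (by
    rw [eq_neg_of_add_eq_zero_left h2]; exact J.neg_mem h1)
  obtain ⟨h, hI, hlt, hh⟩ := hIJ.exists_lift _ h3 m
  refine ⟨h, hI, mem_degLT_of_homogeneousComponent_eq_zero (Submodule.sub_mem _ ha hlt) ?_⟩
  rw [map_sub, hh, homogeneousComponent_eq_self (homogeneousComponent_isHomogeneous m a), sub_self]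

include hIJ hf hreg in
theorem mem_of_mul_mem {a : MvPolynomial σ K} (ha : a * f ∈ I) : a ∈ I := by
  suffices key : ∀ N, ∀ a ∈ degLT σ K N, a * f ∈ I → a ∈ I from
    key _ a (mem_degLT_totalDegree_succ a) ha
  intro N
  induction N with
  | zero =>
    intro a ha _
    rw [eq_zero_of_mem_degLT_zero ha]
    exact I.zero_mem
  | succ m ih =>
    intro a ha haf
    obtain ⟨h, hI, hlt⟩ := hIJ.exists_sub_mem_degLT hf hreg (I.neg_mem haf) ha
      (by rw [neg_add_cancel]; exact Submodule.zero_mem _)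
    have := ih _ hlt (by rw [sub_mul]; exact I.sub_mem haf (I.mul_mem_right _ hI))
    have := I.add_mem this hI
    rwa [sub_add_cancel] at this

include hIJ hf hreg in
-- A representation of `h` can be chosen without cancellation in high degree: as long as `a` is too
-- large, replace it by `a - h'` with `h' ∈ I` and move `h' * f` into the first summand.
theorem exists_add_mul_eq {D : ℕ} {h : MvPolynomial σ K} (hh : h ∈ I ⊔ Ideal.span {f})
    (hD : h ∈ degLT σ K D) :
    ∃ g ∈ I, g ∈ degLT σ K D ∧ ∃ a ∈ degLT σ K (D - d), g + a * f = h := by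
  suffices key : ∀ N, ∀ a ∈ degLT σ K N, ∀ g ∈ I, g + a * f ∈ degLT σ K D →
      ∃ g' ∈ I, ∃ a' ∈ degLT σ K (D - d), g' + a' * f = g + a * f by
    obtain ⟨g, hg, b, hb, rfl⟩ := Submodule.mem_sup.mp hh
    obtain ⟨a, rfl⟩ := Ideal.mem_span_singleton'.mp hb
    obtain ⟨g', hg', a', ha', h'⟩ := key _ a (mem_degLT_totalDegree_succ a) g hg hD
    refine ⟨g', hg', ?_, a', ha', h'⟩
    have := Submodule.sub_mem _ hD (mul_mem_degLT_of_tsub ha' hf)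
    rwa [← h', add_sub_cancel_right] at this
  intro N
  induction N with
  | zero =>
    intro a ha g hg _
    exact ⟨g, hg, a, degLT_mono (Nat.zero_le _) ha, rfl⟩
  | succ m ih =>
    intro a ha g hg hga
    by_cases hm : m + d < D
    · exact ⟨g, hg, a, degLT_mono (by omega) ha, rfl⟩
    · obtain ⟨h, hI, hlt⟩ := hIJ.exists_sub_mem_degLT hf hreg hg ha
        (degLT_mono (not_lt.mp hm) hga)
      have heq : (g + h * f) + (a - h) * f = g + a * f := by ring
      have := ih _ hlt (g + h * f) (I.add_mem hg (I.mul_mem_right _ hI)) (by rwa [heq])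
      rwa [heq] at this

include hIJ hf hreg in
-- The cancellation-free representation lets top forms be read off summand by summand; this is the
-- inductive step along a regular sequence.
theorem sup_span_singleton :
    IsLeadingFormIdeal (I ⊔ Ideal.span {f}) (J ⊔ Ideal.span {homogeneousComponent d f}) where
  component_mem m h hh hm := by
    obtain ⟨g, hg, hgm, a, ha, rfl⟩ := hIJ.exists_add_mul_eq hf hreg hh hm
    rw [map_add]
    refine Ideal.add_mem _ (Ideal.mem_sup_left (hIJ.component_mem m g hg hgm)) ?_
    by_cases hd : d ≤ m
    · obtain ⟨k, rfl⟩ := Nat.exists_eq_add_of_le' hd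
      rw [homogeneousComponent_mul_of_mem_degLT (degLT_mono (by omega) ha) hf]
      exact Ideal.mem_sup_right (Ideal.mul_mem_left _ _ (Ideal.mem_span_singleton_self _))
    · rw [show m + 1 - d = 0 by omega] at ha
      rw [eq_zero_of_mem_degLT_zero ha, zero_mul, map_zero]
      exact Ideal.zero_mem _
  exists_lift c hc m := by
    obtain ⟨g, hg, b, hb, rfl⟩ := Submodule.mem_sup.mp hc
    obtain ⟨a, rfl⟩ := Ideal.mem_span_singleton'.mp hb
    obtain ⟨h, hI, hlt, hh⟩ := hIJ.exists_lift g hg m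
    have hhom := homogeneousComponent_isHomogeneous d f
    by_cases hd : d ≤ m
    · obtain ⟨k, rfl⟩ := Nat.exists_eq_add_of_le' hd
      refine ⟨h + homogeneousComponent k a * f, Ideal.add_mem _ (Ideal.mem_sup_left hI)
        (Ideal.mem_sup_right (Ideal.mul_mem_left _ _ (Ideal.mem_span_singleton_self _))),
        Submodule.add_mem _ hlt ?_, ?_⟩
      · have := mul_mem_degLT (homogeneousComponent_mem_degLT k a) hf
        rwa [show k + 1 + d = k + d + 1 by omega] at this
      · rw [map_add, map_add, hh, homogeneousComponent_add_mul_of_isHomogeneous hhom,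
          homogeneousComponent_mul_of_mem_degLT (homogeneousComponent_mem_degLT k a) hf,
          homogeneousComponent_eq_self (homogeneousComponent_isHomogeneous k a)]
    · refine ⟨h, Ideal.mem_sup_left hI, hlt, ?_⟩
      rw [map_add, homogeneousComponent_mul_eq_zero_of_lt hhom (not_le.mp hd), hh, add_zero]

end IsLeadingFormIdeal

end LeadingForms

/-! ### Monomial bases compatible with degree. -/

section GradedMonomialBasis

variable {σ K : Type*} [CommRing K]

theorem mk_monomial_eq_smul (I : Ideal (MvPolynomial σ K)) (v : σ →₀ ℕ) (c : K) :
    Ideal.Quotient.mk I (monomial v c) = c • Ideal.Quotient.mk I (monomial v 1) := by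
  have h : monomial v c = c • (monomial v (1 : K)) := by rw [smul_monomial, smul_eq_mul, mul_one]
  rw [h]
  rfl

/-- A set of monomials that are linearly independent modulo `I`, and such that each monomial is
congruent to a polynomial supported on the set without increase of the degree. -/
structure IsGradedMonomialBasis (I : Ideal (MvPolynomial σ K)) (S : Set (σ →₀ ℕ)) :
    Prop where
  eq_zero_of_mem : ∀ r ∈ I, (∀ v ∈ r.support, v ∈ S) → r = 0
  exists_sub_mem : ∀ u : σ →₀ ℕ, ∃ r : MvPolynomial σ K, monomial u 1 - r ∈ I ∧
    ∀ v ∈ r.support, v ∈ S ∧ v.degree ≤ u.degree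

theorem isGradedMonomialBasis_bot :
    IsGradedMonomialBasis (⊥ : Ideal (MvPolynomial σ K)) Set.univ where
  eq_zero_of_mem r hr _ := Ideal.mem_bot.mp hr
  exists_sub_mem u := ⟨monomial u 1, by simp, fun v hv => by
    rw [Finset.mem_singleton.mp (support_monomial_subset hv)]
    exact ⟨trivial, le_rfl⟩⟩

theorem IsGradedMonomialBasis.linearIndependent {I : Ideal (MvPolynomial σ K)}
    {S : Set (σ →₀ ℕ)} (hS : IsGradedMonomialBasis I S) {ι : Type*} {u : ι → σ →₀ ℕ}
    (hu : Function.Injective u) (huS : ∀ i, u i ∈ S) :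
    LinearIndependent K fun i => Ideal.Quotient.mk I (monomial (u i) 1) := by
  have h : LinearIndependent K fun i => (monomial (u i) 1 : MvPolynomial σ K) :=
    (basisMonomials σ K).linearIndependent.comp u hu
  have h' : LinearIndependent K
      ((Ideal.Quotient.mkₐ K I).toLinearMap ∘
        fun i => (monomial (u i) 1 : MvPolynomial σ K)) := by
    apply h.map
    rw [Submodule.disjoint_def]
    intro p hp hker
    refine hS.eq_zero_of_mem p (Ideal.Quotient.eq_zero_iff_mem.mp hker) ?_
    have hle : Submodule.span K (Set.range fun i => (monomial (u i) 1 : MvPolynomial σ K))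
        ≤ restrictSupport K S := by
      rw [Submodule.span_le]
      rintro _ ⟨i, rfl⟩
      rw [SetLike.mem_coe, monomial_mem_restrictSupport]
      exact Or.inl (huS i)
    exact fun v hv => (mem_restrictSupport_iff K).mp (hle hp) hv
  exact h'

theorem IsGradedMonomialBasis.mem_span {I : Ideal (MvPolynomial σ K)} {S : Set (σ →₀ ℕ)}
    (hS : IsGradedMonomialBasis I S) (p : MvPolynomial σ K) :
    Ideal.Quotient.mk I p ∈
      Submodule.span K (Set.range fun b : S => Ideal.Quotient.mk I (monomial b.1 (1 : K))) := by
  have key : ∀ v ∈ S, Ideal.Quotient.mk I (monomial v (1 : K)) ∈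
      Submodule.span K (Set.range fun b : S => Ideal.Quotient.mk I (monomial b.1 (1 : K))) :=
    fun v hv => Submodule.subset_span ⟨⟨v, hv⟩, rfl⟩
  rw [p.as_sum, map_sum]
  refine Submodule.sum_mem _ fun u _ => ?_
  rw [mk_monomial_eq_smul]
  refine Submodule.smul_mem _ _ ?_
  obtain ⟨r, hr, hsupp⟩ := hS.exists_sub_mem u
  rw [(Ideal.Quotient.mk_eq_mk_iff_sub_mem _ _).mpr hr, r.as_sum, map_sum]
  refine Submodule.sum_mem _ fun v hv => ?_
  rw [mk_monomial_eq_smul]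
  exact Submodule.smul_mem _ _ (key v (hsupp v hv).1)

/-- The basis of the quotient formed by the classes of the monomials. -/
noncomputable def IsGradedMonomialBasis.basis {I : Ideal (MvPolynomial σ K)} {S : Set (σ →₀ ℕ)}
    (hS : IsGradedMonomialBasis I S) : Module.Basis S K (MvPolynomial σ K ⧸ I) :=
  Module.Basis.mk (hS.linearIndependent Subtype.val_injective fun b => b.2) fun z _ => by
    obtain ⟨p, rfl⟩ := Ideal.Quotient.mk_surjective z
    exact hS.mem_span p

theorem IsGradedMonomialBasis.basis_apply {I : Ideal (MvPolynomial σ K)} {S : Set (σ →₀ ℕ)}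
    (hS : IsGradedMonomialBasis I S) (b : S) :
    hS.basis b = Ideal.Quotient.mk I (monomial b.1 1) :=
  Module.Basis.mk_apply _ _ b

theorem IsGradedMonomialBasis.basis_repr_mk {I : Ideal (MvPolynomial σ K)} {S : Set (σ →₀ ℕ)}
    (hS : IsGradedMonomialBasis I S) {p : MvPolynomial σ K} (hp : ∀ v ∈ p.support, v ∈ S)
    (b : S) : hS.basis.repr (Ideal.Quotient.mk I p) b = coeff b.1 p := by
  classical
  have h : Ideal.Quotient.mk I p = ∑ v ∈ p.support.attach,
      coeff v.1 p • hS.basis ⟨v.1, hp v.1 v.2⟩ := by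
    conv_lhs => rw [p.as_sum, map_sum, ← Finset.sum_attach]
    refine Finset.sum_congr rfl fun v _ => ?_
    rw [mk_monomial_eq_smul, hS.basis_apply]
  rw [h, map_sum, Finsupp.finsetSum_apply]
  simp only [map_smul, Module.Basis.repr_self, Finsupp.smul_apply, smul_eq_mul,
    Finsupp.single_apply, Subtype.ext_iff, mul_ite, mul_one, mul_zero]
  by_cases hb : b.1 ∈ p.support
  · rw [Finset.sum_eq_single ⟨b.1, hb⟩] <;> simp [Subtype.ext_iff]
    · intro a _ h1 h2
      exact absurd h2 h1
  · rw [Finset.sum_eq_zero, notMem_support_iff.mp hb]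
    rintro v -
    rw [if_neg]
    rintro h
    exact hb (h ▸ v.2)

end GradedMonomialBasis

/-! ### The affine Hilbert series, computed in two ways. -/

section HilbertFunction

variable {n : ℕ} {K : Type*} [Field K]

instance finiteDimensional_degLT (N : ℕ) : FiniteDimensional K (degLT (Fin n) K N) := by
  have : Finite {u : Fin n →₀ ℕ | u.degree < N} := Finsupp.finite_of_degree_lt N
  exact Module.Finite.of_basis (basisRestrictSupport K {u : Fin n →₀ ℕ | u.degree < N})

/-- The affine Hilbert function of `I`: the dimension of the image in the quotient by `I` of the
space of polynomials of degree less than `N`. -/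
noncomputable def affineHilbert (I : Ideal (MvPolynomial (Fin n) K)) (N : ℕ) : ℕ :=
  Module.finrank K ((degLT (Fin n) K N).map (Ideal.Quotient.mkₐ K I).toLinearMap)

theorem finrank_map_add_finrank_inf_ker {V V' : Type*} [AddCommGroup V] [Module K V]
    [AddCommGroup V'] [Module K V'] (φ : V →ₗ[K] V') (W : Submodule K V) [FiniteDimensional K W] :
    Module.finrank K (W.map φ) + Module.finrank K (W ⊓ LinearMap.ker φ : Submodule K V)
      = Module.finrank K W := by
  rw [← LinearMap.finrank_range_add_finrank_ker (φ.domRestrict W), LinearMap.range_domRestrict,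
    LinearMap.ker_domRestrict, ← Submodule.finrank_map_subtype_eq W,
    Submodule.map_comap_subtype]

/-- Rank-nullity for the projection between the two filtered quotients. Its kernel is `f` times the
image of degree less than `N - d`: `exists_add_mul_eq` gives this with the sharp degree, and
`mem_of_mul_mem` makes multiplication by `f` injective. -/
theorem affineHilbert_sup_span_singleton {I J : Ideal (MvPolynomial (Fin n) K)}
    (hIJ : IsLeadingFormIdeal I J) {f : MvPolynomial (Fin n) K} {d : ℕ}
    (hf : f ∈ degLT (Fin n) K (d + 1)) (hreg : ∀ a, a * homogeneousComponent d f ∈ J → a ∈ J)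
    (N : ℕ) :
    affineHilbert (I ⊔ Ideal.span {f}) N + affineHilbert I (N - d) = affineHilbert I N := by
  set π : (MvPolynomial (Fin n) K ⧸ I) →ₐ[K] (MvPolynomial (Fin n) K ⧸ (I ⊔ Ideal.span {f})) :=
    Ideal.Quotient.factorₐ K le_sup_left with hπ
  set W := (degLT (Fin n) K N).map (Ideal.Quotient.mkₐ K I).toLinearMap with hW
  set U := (degLT (Fin n) K (N - d)).map (Ideal.Quotient.mkₐ K I).toLinearMap with hU
  have h1 : (degLT (Fin n) K N).map (Ideal.Quotient.mkₐ K (I ⊔ Ideal.span {f})).toLinearMap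
      = W.map π.toLinearMap := by
    rw [hW, ← Submodule.map_comp]
    rfl
  set μ := LinearMap.mulRight K (Ideal.Quotient.mk I f) with hμ
  have hinj : Function.Injective μ := by
    rw [injective_iff_map_eq_zero]
    intro a ha
    obtain ⟨a, rfl⟩ := Ideal.Quotient.mk_surjective a
    rw [hμ, LinearMap.mulRight_apply, ← map_mul, Ideal.Quotient.eq_zero_iff_mem] at ha
    exact Ideal.Quotient.eq_zero_iff_mem.mpr (hIJ.mem_of_mul_mem hf hreg ha)
  have h2 : W ⊓ LinearMap.ker π.toLinearMap = U.map μ := by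
    ext z
    constructor
    · rintro ⟨⟨p, hp, rfl⟩, hz⟩
      have hp' : p ∈ I ⊔ Ideal.span {f} := Ideal.Quotient.eq_zero_iff_mem.mp hz
      obtain ⟨g, hg, -, a, ha, rfl⟩ := hIJ.exists_add_mul_eq hf hreg hp' hp
      refine ⟨Ideal.Quotient.mk I a, ⟨a, ha, rfl⟩, ?_⟩
      change Ideal.Quotient.mk I a * Ideal.Quotient.mk I f = Ideal.Quotient.mk I (g + a * f)
      rw [map_add, Ideal.Quotient.eq_zero_iff_mem.mpr hg, zero_add, map_mul]
    · rintro ⟨_, ⟨a, ha, rfl⟩, rfl⟩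
      refine ⟨⟨a * f, mul_mem_degLT_of_tsub ha hf, map_mul (Ideal.Quotient.mk I) a f⟩, ?_⟩
      change Ideal.Quotient.mk (I ⊔ Ideal.span {f}) (a * f) = 0
      exact Ideal.Quotient.eq_zero_iff_mem.mpr
        (Ideal.mem_sup_right (Ideal.mul_mem_left _ _ (Ideal.mem_span_singleton_self _)))
  have h3 : Module.finrank K (U.map μ) = Module.finrank K U :=
    (Submodule.equivMapOfInjective μ hinj U).finrank_eq.symm
  rw [affineHilbert, affineHilbert, affineHilbert, h1, ← h3, ← h2]
  exact finrank_map_add_finrank_inf_ker _ _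

theorem affineHilbert_zero (I : Ideal (MvPolynomial (Fin n) K)) : affineHilbert I 0 = 0 := by
  have : degLT (Fin n) K 0 = ⊥ := (Submodule.eq_bot_iff _).mpr fun _ => eq_zero_of_mem_degLT_zero
  rw [affineHilbert, this, Submodule.map_bot, finrank_bot]

/-- The generating series of the affine Hilbert function. -/
noncomputable def affineHilbertSeries (I : Ideal (MvPolynomial (Fin n) K)) : PowerSeries ℤ :=
  PowerSeries.mk fun N => (affineHilbert I N : ℤ)

theorem affineHilbertSeries_sup_span_singleton {I J : Ideal (MvPolynomial (Fin n) K)}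
    (hIJ : IsLeadingFormIdeal I J) {f : MvPolynomial (Fin n) K} {d : ℕ}
    (hf : f ∈ degLT (Fin n) K (d + 1)) (hreg : ∀ a, a * homogeneousComponent d f ∈ J → a ∈ J) :
    affineHilbertSeries (I ⊔ Ideal.span {f})
      = affineHilbertSeries I * (1 - PowerSeries.X ^ d) := by
  ext N
  have h := affineHilbert_sup_span_singleton hIJ hf hreg N
  rw [mul_sub, mul_one, map_sub, PowerSeries.coeff_mul_X_pow']
  simp only [affineHilbertSeries, PowerSeries.coeff_mk]
  split_ifs with hd
  · omega
  · rw [show N - d = 0 by omega, affineHilbert_zero] at h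
    omega

theorem mem_of_mul_mem_of_isSMulRegular {R : Type*} [CommRing R] {J : Ideal R} {r : R}
    (h : IsSMulRegular (R ⧸ (J • ⊤ : Submodule R R)) r) {a : R} (ha : a * r ∈ J) : a ∈ J := by
  have hJ : (J • ⊤ : Submodule R R) = J := by rw [smul_eq_mul, Ideal.mul_top]
  have h0 : r • (Submodule.Quotient.mk a : R ⧸ (J • ⊤ : Submodule R R)) = r • 0 := by
    rw [smul_zero, ← Submodule.Quotient.mk_smul, Submodule.Quotient.mk_eq_zero, hJ, smul_eq_mul,
      mul_comm]
    exact ha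
  have := h h0
  rwa [Submodule.Quotient.mk_eq_zero, hJ] at this

theorem affineHilbertSeries_ofList (fs : List (MvPolynomial (Fin n) K))
    (h : RingTheory.Sequence.IsWeaklyRegular (MvPolynomial (Fin n) K)
      (fs.map fun f => homogeneousComponent f.totalDegree f)) :
    IsLeadingFormIdeal (Ideal.ofList fs)
        (Ideal.ofList (fs.map fun f => homogeneousComponent f.totalDegree f)) ∧
      affineHilbertSeries (Ideal.ofList fs)
        = affineHilbertSeries (⊥ : Ideal (MvPolynomial (Fin n) K))
          * (fs.map fun f => 1 - (PowerSeries.X : PowerSeries ℤ) ^ f.totalDegree).prod := by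
  induction fs using List.reverseRecOn with
  | nil =>
    simp only [List.map_nil, Ideal.ofList_nil, List.prod_nil, mul_one, and_true]
    exact isLeadingFormIdeal_bot
  | append_singleton fs f ih =>
    rw [List.map_append, RingTheory.Sequence.isWeaklyRegular_append_iff, List.map_singleton,
      RingTheory.Sequence.isWeaklyRegular_singleton_iff] at h
    obtain ⟨h1, h2⟩ := ih h.1
    have hreg := fun a => mem_of_mul_mem_of_isSMulRegular h.2 (a := a)
    have hf := mem_degLT_totalDegree_succ f
    simp only [List.map_append, List.map_singleton, Ideal.ofList_append, Ideal.ofList_singleton,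
      List.prod_append, List.prod_singleton]
    refine ⟨h1.sup_span_singleton hf hreg, ?_⟩
    rw [affineHilbertSeries_sup_span_singleton h1 hf hreg, h2, mul_assoc]

/-- Since reduction does not raise degree, basis monomials of degree less than `N` suffice to span
the image. -/
theorem IsGradedMonomialBasis.affineHilbert_eq {I : Ideal (MvPolynomial (Fin n) K)}
    {S : Set (Fin n →₀ ℕ)} (hS : IsGradedMonomialBasis I S) (N : ℕ) :
    affineHilbert I N = Nat.card {b : Fin n →₀ ℕ // b ∈ S ∧ b.degree < N} := by
  have hfin : Finite {b : Fin n →₀ ℕ // b ∈ S ∧ b.degree < N} :=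
    (Finsupp.finite_of_degree_lt N).subset fun b hb => hb.2
  have := Fintype.ofFinite {b : Fin n →₀ ℕ // b ∈ S ∧ b.degree < N}
  have hli : LinearIndependent K fun b : {b : Fin n →₀ ℕ // b ∈ S ∧ b.degree < N} =>
      Ideal.Quotient.mk I (monomial b.1 1) := by
    exact hS.linearIndependent Subtype.val_injective fun b => b.2.1
  set V := Submodule.span K (Set.range fun b : {b : Fin n →₀ ℕ // b ∈ S ∧ b.degree < N} =>
      Ideal.Quotient.mk I (monomial b.1 (1 : K))) with hV
  suffices h : (degLT (Fin n) K N).map (Ideal.Quotient.mkₐ K I).toLinearMap = V by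
    rw [Nat.card_eq_fintype_card, ← finrank_span_eq_card hli, affineHilbert, h]
  apply le_antisymm
  · rw [degLT, restrictSupport_eq_span, Submodule.map_span, Submodule.span_le]
    rintro _ ⟨_, ⟨u, hu, rfl⟩, rfl⟩
    obtain ⟨r, hr, hsupp⟩ := hS.exists_sub_mem u
    change Ideal.Quotient.mk I (monomial u 1) ∈ V
    rw [(Ideal.Quotient.mk_eq_mk_iff_sub_mem _ _).mpr hr, r.as_sum, map_sum]
    refine Submodule.sum_mem _ fun v hv => ?_
    have hmem : Ideal.Quotient.mk I (monomial v (1 : K)) ∈ V :=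
      Submodule.subset_span ⟨⟨v, (hsupp v hv).1, (hsupp v hv).2.trans_lt hu⟩, rfl⟩
    rw [mk_monomial_eq_smul]
    exact V.smul_mem _ hmem
  · rw [Submodule.span_le]
    rintro _ ⟨b, rfl⟩
    refine ⟨monomial b.1 1, ?_, rfl⟩
    change _ ∈ restrictSupport _ _
    rw [monomial_mem_restrictSupport]
    exact Or.inl b.2.2

theorem card_degree_lt_succ (n N : ℕ) :
    Nat.card {b : Fin n →₀ ℕ // b ∈ Set.univ ∧ b.degree < N + 1} = (n + N).choose n := by
  have hcard : ∀ m, ((Finset.univ : Finset (Fin n)).finsuppAntidiag m).card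
      = (n + m - 1).choose m := fun m => by
    rw [Finset.card_finsuppAntidiag_nat_eq_choose, Finset.card_univ, Fintype.card_fin]
  have h1 : Nat.card {b : Fin n →₀ ℕ // b ∈ Set.univ ∧ b.degree < N + 1}
      = ((Finset.range (N + 1)).biUnion fun m =>
        (Finset.univ : Finset (Fin n)).finsuppAntidiag m).card := by
    refine Nat.subtype_card _ fun b => ?_
    simp only [Finset.mem_biUnion, Finset.mem_range, Finset.mem_finsuppAntidiag,
      Finset.subset_univ, and_true, Set.mem_univ, true_and, Finsupp.degree_eq_sum]
    exact ⟨fun ⟨m, hm, h⟩ => h ▸ hm, fun h => ⟨_, h, rfl⟩⟩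
  rw [h1, Finset.card_biUnion]
  · rw [Finset.sum_congr rfl fun m _ => hcard m, Nat.choose_symm_add]
    clear h1
    induction N with
    | zero => simp
    | succ N ih =>
      rw [Finset.sum_range_succ, ih, show n + (N + 1) - 1 = n + N by omega, ← add_assoc n N 1,
        Nat.choose_succ_succ]
  · intro a _ b _ hab
    rw [Function.onFun, Finset.disjoint_left]
    intro u hu hu'
    rw [Finset.mem_finsuppAntidiag] at hu hu'
    exact hab (hu.1.symm.trans hu'.1)

/-- The series is `X / (1 - X) ^ (n + 1)`; the numerator `X` reflects counting degrees strictly less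
than `N`. -/
theorem affineHilbertSeries_bot_mul :
    affineHilbertSeries (⊥ : Ideal (MvPolynomial (Fin n) K)) * (1 - PowerSeries.X) ^ (n + 1)
      = PowerSeries.X := by
  have h : affineHilbertSeries (⊥ : Ideal (MvPolynomial (Fin n) K))
      = (PowerSeries.mk 1) ^ (n + 1) * PowerSeries.X := by
    rw [PowerSeries.mk_one_pow_eq_mk_choose_add]
    ext N
    rw [affineHilbertSeries, PowerSeries.coeff_mk]
    cases N with
    | zero => rw [affineHilbert_zero, PowerSeries.coeff_zero_mul_X, Nat.cast_zero]
    | succ N =>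
      rw [PowerSeries.coeff_succ_mul_X, isGradedMonomialBasis_bot.affineHilbert_eq,
        card_degree_lt_succ, PowerSeries.coeff_mk]
  rw [h, mul_right_comm, ← mul_pow, PowerSeries.mk_one_mul_one_sub_eq_one, one_pow, one_mul]

/-- Each `b` is counted from `N = deg b + 1` onward, so it contributes `X ^ (deg b + 1) / (1 - X)`.
-/
theorem IsGradedMonomialBasis.affineHilbertSeries_mul {I : Ideal (MvPolynomial (Fin n) K)}
    {S : Set (Fin n →₀ ℕ)} (hS : IsGradedMonomialBasis I S) [Fintype S] :
    affineHilbertSeries I * (1 - PowerSeries.X)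
      = (∑ b : S, PowerSeries.X ^ b.1.degree) * PowerSeries.X := by
  have h : affineHilbertSeries I
      = (PowerSeries.mk 1) * ((∑ b : S, PowerSeries.X ^ b.1.degree) * PowerSeries.X) := by
    ext N
    rw [affineHilbertSeries, PowerSeries.coeff_mk, hS.affineHilbert_eq, Finset.sum_mul,
      Finset.mul_sum, map_sum]
    have h1 : Nat.card {b : Fin n →₀ ℕ // b ∈ S ∧ b.degree < N}
        = (Finset.univ.filter fun b : S => b.1.degree < N).card := by
      rw [← Nat.subtype_card (p := fun b : S => b.1.degree < N) _ (by simp)]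
      exact Nat.card_congr (Equiv.subtypeSubtypeEquivSubtypeInter (· ∈ S)
        (fun b : Fin n →₀ ℕ => b.degree < N)).symm
    rw [h1, Finset.card_filter, Nat.cast_sum]
    refine Finset.sum_congr rfl fun b _ => ?_
    rw [← pow_succ, PowerSeries.coeff_mul_X_pow', PowerSeries.coeff_mk]
    simp
  rw [h, mul_right_comm, PowerSeries.mk_one_mul_one_sub_eq_one, one_mul]

open scoped Polynomial in
-- Equate the Hilbert series given by the regular sequence with the one given by the basis. The
-- comparison takes place in power series and returns to polynomials by injectivity, after
-- cancelling `X`.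
theorem IsGradedMonomialBasis.sum_X_pow_mul {e : ℕ} {f : Fin e → MvPolynomial (Fin n) K}
    {S : Set (Fin n →₀ ℕ)} (hS : IsGradedMonomialBasis (Ideal.span (Set.range f)) S) [Fintype S]
    (hf : IsAffineRegularSeq f) :
    (∑ b : S, (Polynomial.X : ℤ[X]) ^ b.1.degree) * (1 - Polynomial.X) ^ n = ∏ i, (1 - Polynomial.X ^ (f i).totalDegree) := by
  have hI : Ideal.span (Set.range f) = Ideal.ofList (List.ofFn f) := by
    rw [Ideal.ofList]
    congr 1
    ext p
    simp [List.mem_ofFn]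
  have h1 := (affineHilbertSeries_ofList (List.ofFn f)
    (by rw [List.map_ofFn]; exact hf.2.2)).2
  rw [← hI, List.map_ofFn, List.prod_ofFn] at h1
  have h2 := hS.affineHilbertSeries_mul
  have h3 := affineHilbertSeries_bot_mul (n := n) (K := K)
  rw [← Polynomial.coe_inj]
  have hX : (PowerSeries.X : PowerSeries ℤ) ≠ 0 := PowerSeries.X_ne_zero
  apply mul_right_cancel₀ hX
  have h4 : ((∑ b : S, (Polynomial.X : ℤ[X]) ^ b.1.degree : ℤ[X]) : PowerSeries ℤ)
      = ∑ b : S, PowerSeries.X ^ b.1.degree := by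
    rw [← Polynomial.coeToPowerSeries.ringHom_apply, map_sum]
    simp
  have h5 : ((∏ i, (1 - Polynomial.X ^ (f i).totalDegree) : ℤ[X]) : PowerSeries ℤ)
      = ∏ i, (1 - PowerSeries.X ^ (f i).totalDegree) := by
    rw [← Polynomial.coeToPowerSeries.ringHom_apply, map_prod]
    simp
  rw [Polynomial.coe_mul, h4, h5, Polynomial.coe_pow, Polynomial.coe_sub, Polynomial.coe_one,
    Polynomial.coe_X]
  simp only [Function.comp_def] at h1
  linear_combination (-(1 - PowerSeries.X) ^ n) * h2 + (1 - PowerSeries.X) ^ (n + 1) * h1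
    + (∏ i, (1 - PowerSeries.X ^ (f i).totalDegree)) * h3

end HilbertFunction

/-! ### Cardinality and degree sum from the generating polynomial. -/

section DegreeSum

open scoped Polynomial

theorem two_mul_sum_range_cast (d : ℕ) :
    2 * ∑ i ∈ Finset.range d, (i : ℤ) = d * (d - 1) := by
  induction d with
  | zero => simp
  | succ d ih => rw [Finset.sum_range_succ, mul_add, ih]; push_cast; ring

/-- The product rule, each factor having value `d i` and derivative `d i * (d i - 1) / 2` at `1`;
doubling keeps the identity in `ℤ`. -/
theorem two_mul_eval_derivative_prod_geom {ι : Type*} (s : Finset ι) (d : ι → ℕ) :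
    2 * (Polynomial.derivative (∏ i ∈ s, ∑ j ∈ Finset.range (d i), (Polynomial.X : ℤ[X]) ^ j)).eval 1
      = (∏ i ∈ s, (d i : ℤ)) * ∑ i ∈ s, ((d i : ℤ) - 1) := by
  classical
  induction s using Finset.induction_on with
  | empty => simp
  | insert i s hi ih =>
    have h1 : ∀ k : ℕ, (∑ j ∈ Finset.range k, (Polynomial.X : ℤ[X]) ^ j).eval 1 = k := fun k => by
      simp [Polynomial.eval_finsetSum]
    have h2 : 2 * (Polynomial.derivative (∑ j ∈ Finset.range (d i), (Polynomial.X : ℤ[X]) ^ j)).eval 1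
        = d i * (d i - 1) := by
      rw [← two_mul_sum_range_cast]
      simp [Polynomial.eval_finsetSum, Polynomial.derivative_X_pow]
    rw [Finset.prod_insert hi, Finset.prod_insert hi, Finset.sum_insert hi, Polynomial.derivative_mul,
      Polynomial.eval_add, Polynomial.eval_mul, Polynomial.eval_mul, h1, Polynomial.eval_prod, Finset.prod_congr rfl fun j _ => h1 (d j)]
    linear_combination (∏ i ∈ s, (d i : ℤ)) * h2 + (d i : ℤ) * ih

/-- The number of elements of a finite family of degrees and their sum, from a factorization of
the generating polynomial. -/
theorem sum_le_of_sum_X_pow_mul {ι : Type*} [Fintype ι] (δ : ι → ℕ) {n e : ℕ} (hen : e ≤ n)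
    (k : Fin e → ℕ)
    (h : (∑ b, (Polynomial.X : ℤ[X]) ^ δ b) * (1 - Polynomial.X) ^ n = ∏ i, (1 - Polynomial.X ^ k i)) {d : ℕ}
    (hd : ∀ i, k i ≤ d) (A : ℕ) :
    ∑ b, ((A : ℤ) + 2 * δ b) ≤ ((A : ℤ) + n * ((d : ℤ) - 1)) * (d : ℤ) ^ n := by
  have hX : (1 - Polynomial.X : ℤ[X]) ≠ 0 := fun h0 => by
    have := congrArg (Polynomial.eval 0) h0
    simp at this
  have hcard : (∑ b, (Polynomial.X : ℤ[X]) ^ δ b).eval 1 = Fintype.card ι := by simp [Polynomial.eval_finsetSum]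
  -- A zero exponent kills the right-hand product, so the family is empty and only the sign of the
  -- bound matters. If `d = 0`, then `d ^ n = 0`, because an index in `Fin e` and `e ≤ n` force `n >
  -- 0`.
  by_cases hk : ∃ i, k i = 0
  · obtain ⟨i, hi⟩ := hk
    rw [Finset.prod_eq_zero (Finset.mem_univ i) (by rw [hi, pow_zero, sub_self])] at h
    have h0 := (mul_eq_zero.mp h).resolve_right (pow_ne_zero _ hX)
    rw [h0, Polynomial.eval_zero] at hcard
    have : IsEmpty ι := Fintype.card_eq_zero_iff.mp (by exact_mod_cast hcard.symm)
    rw [Finset.univ_eq_empty, Finset.sum_empty]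
    rcases Nat.eq_zero_or_pos d with rfl | hd0
    · rw [Nat.cast_zero, zero_pow (by have := i.2; omega), mul_zero]
    · have : (0 : ℤ) ≤ (d : ℤ) - 1 := by omega
      positivity
  · push Not at hk
    have hgeom : ∏ i, (1 - (Polynomial.X : ℤ[X]) ^ k i)
        = (1 - Polynomial.X) ^ e * ∏ i, ∑ j ∈ Finset.range (k i), (Polynomial.X : ℤ[X]) ^ j := by
      rw [Finset.prod_congr rfl fun i _ => (mul_neg_geom_sum (Polynomial.X : ℤ[X]) (k i)).symm,
        Finset.prod_mul_distrib, Finset.prod_const, Finset.card_univ, Fintype.card_fin]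
    obtain ⟨m, rfl⟩ := Nat.exists_eq_add_of_le hen
    rw [hgeom, pow_add, mul_left_comm] at h
    have h1 := mul_left_cancel₀ (pow_ne_zero _ hX) h
    have hprod : (∏ i, ∑ j ∈ Finset.range (k i), (Polynomial.X : ℤ[X]) ^ j).eval 1 = ∏ i, (k i : ℤ) := by
      rw [Polynomial.eval_prod]
      exact Finset.prod_congr rfl fun i _ => by simp [Polynomial.eval_finsetSum]
    have hne : ∏ i, (k i : ℤ) ≠ 0 :=
      Finset.prod_ne_zero_iff.mpr fun i _ => by exact_mod_cast hk i
    -- Here `m = n - e`. A leftover factor `1 - X` would vanish at `1`, whereas the product of the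
    -- positive `k i` does not.
    obtain rfl : m = 0 := by
      by_contra hm
      apply hne
      rw [← hprod, ← h1, Polynomial.eval_mul, Polynomial.eval_pow]
      simp [hm]
    rw [pow_zero, mul_one] at h1
    have hc : (Fintype.card ι : ℤ) = ∏ i, (k i : ℤ) := by rw [← hcard, h1, hprod]
    have hs : 2 * ∑ b, (δ b : ℤ) = (∏ i, (k i : ℤ)) * ∑ i, ((k i : ℤ) - 1) := by
      rw [← two_mul_eval_derivative_prod_geom, ← h1]
      simp [Polynomial.eval_finsetSum, Polynomial.derivative_X_pow]
    rw [Finset.sum_add_distrib, Finset.sum_const, Finset.card_univ, ← Finset.mul_sum, hs,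
      nsmul_eq_mul, hc, ← mul_add, mul_comm]
    have h2 : ∑ i, ((k i : ℤ) - 1) ≤ e * ((d : ℤ) - 1) := by
      refine (Finset.sum_le_card_nsmul _ _ ((d : ℤ) - 1) fun i _ => ?_).trans_eq (by simp)
      have := hd i
      omega
    have h3 : ∏ i, (k i : ℤ) ≤ (d : ℤ) ^ e := by
      refine (Finset.prod_le_prod (fun i _ => by positivity)
        fun i _ => (by exact_mod_cast hd i : (k i : ℤ) ≤ d)).trans_eq (by simp)
    have h4 : 0 ≤ ∑ i, ((k i : ℤ) - 1) := Finset.sum_nonneg fun i _ => by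
      have := hk i
      omega
    rw [add_zero]
    exact mul_le_mul (by linarith) h3 (Finset.prod_nonneg fun i _ => by positivity) (by linarith)

end DegreeSum

/-! ### The standard monomials as a basis, and polynomial traces. -/

section ParametricBasis

variable {t n e : ℕ} {f : Fin e → ParamPoly t n} {G : Set (ParamPoly t n)}

/-- The basis already exists over `ℚ[y]`; this freeness allows both localization to `ℚ(y)` and
specialization at a point. -/
theorem isGradedMonomialBasis_sumAlgEquiv
    (hG : IsReducedGroebnerBasis (elimOrder (grevlex n) (grevlex t))
      (Ideal.span (Set.range f)) G)
    (hdeg : ∀ p ∈ G, p.totalDegree = degX p) :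
    IsGradedMonomialBasis
      (Ideal.span (Set.range fun i => sumAlgEquiv ℚ (Fin n) (Fin t) (f i)))
      (standardMonomials G) := by
  have hmap : Ideal.span (Set.range fun i => sumAlgEquiv ℚ (Fin n) (Fin t) (f i))
      = (Ideal.span (Set.range f)).map (sumAlgEquiv ℚ (Fin n) (Fin t)).toRingEquiv := by
    rw [Ideal.map_span, ← Set.range_comp]
    rfl
  refine ⟨fun r hr hS => ?_, fun u => ?_⟩
  · rw [hmap] at hr
    obtain ⟨q, hq, rfl⟩ := (Ideal.mem_map_iff_of_surjective _
      (sumAlgEquiv ℚ (Fin n) (Fin t)).toRingEquiv.surjective).mp hr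
    rw [eq_zero_of_mem_of_support_subset_standardMonomials hG hq hS, map_zero]
  · obtain ⟨r, hr, hle, hS⟩ := exists_normalForm hG hdeg (monomial (Finsupp.sumElim u 0) 1)
    refine ⟨sumAlgEquiv ℚ (Fin n) (Fin t) r, ?_, fun v hv => ⟨hS v hv, ?_⟩⟩
    · have h1 : monomial u 1
          = sumAlgEquiv ℚ (Fin n) (Fin t) (monomial (Finsupp.sumElim u 0) 1) := by
        rw [sumAlgEquiv_monomial, xPart_sumElim, yPart_sumElim]
        rfl
      rw [h1, ← map_sub, hmap]
      exact Ideal.mem_map_of_mem _ hr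
    · have h1 := degree_le_totalDegree hv
      have h2 := totalDegree_sumAlgEquiv_le r
      have h3 := totalDegree_monomial_le (Finsupp.sumElim u (0 : Fin t →₀ ℕ)) (1 : ℚ)
      have h4 := degree_xPart_add_degree_yPart (Finsupp.sumElim u (0 : Fin t →₀ ℕ))
      rw [xPart_sumElim, yPart_sumElim, map_zero] at h4
      have h5 : (Finsupp.sumElim u (0 : Fin t →₀ ℕ)).sum (fun _ => id)
        = (Finsupp.sumElim u (0 : Fin t →₀ ℕ)).degree := rfl
      omega

/-- For independence, clear denominators: a nonzero scalar multiple of `r` comes from `I` and has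
its support in `S`. Reductions are simply mapped. -/
theorem IsGradedMonomialBasis.map_fractionRing {σ R K : Type*} [CommRing R] [IsDomain R] [Field K]
    [Algebra R K] [IsFractionRing R K] {I : Ideal (MvPolynomial σ R)} {S : Set (σ →₀ ℕ)}
    (hS : IsGradedMonomialBasis I S) :
    IsGradedMonomialBasis (I.map (map (algebraMap R K))) S := by
  have hinj : Function.Injective (algebraMap R K) := IsFractionRing.injective R K
  refine ⟨fun r hr hsupp => ?_, fun u => ?_⟩
  · let _ : Algebra (MvPolynomial σ R) (MvPolynomial σ K) := algebraMvPolynomial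
    have : IsLocalization (Submonoid.map C (nonZeroDivisors R)) (MvPolynomial σ K) :=
      MvPolynomial.isLocalization (nonZeroDivisors R) K
    obtain ⟨⟨⟨h, hI⟩, ⟨_, s, hs, rfl⟩⟩, heq⟩ :=
      (IsLocalization.mem_map_algebraMap_iff (Submonoid.map C (nonZeroDivisors R))
        (MvPolynomial σ K)).mp hr
    change r * map (algebraMap R K) (C s) = map (algebraMap R K) h at heq
    rw [map_C, mul_comm] at heq
    have h0 : h = 0 := by
      refine hS.eq_zero_of_mem h hI fun v hv => hsupp v ?_
      rw [← support_map_of_injective h hinj, ← heq, mem_support_iff, coeff_C_mul] at hv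
      exact mem_support_iff.mpr (right_ne_zero_of_mul hv)
    rw [h0, map_zero] at heq
    refine (mul_eq_zero.mp heq).resolve_left fun hc => nonZeroDivisors.ne_zero hs (hinj ?_)
    rw [map_zero]
    exact C_eq_zero.mp hc
  · obtain ⟨r, hr, hsupp⟩ := hS.exists_sub_mem u
    refine ⟨map (algebraMap R K) r, ?_, fun v hv => hsupp v ?_⟩
    · have := Ideal.mem_map_of_mem (map (algebraMap R K)) hr
      rwa [map_sub, map_monomial, map_one] at this
    · rwa [support_map_of_injective r hinj] at hv

theorem isGradedMonomialBasis_toKx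
    (hG : IsReducedGroebnerBasis (elimOrder (grevlex n) (grevlex t))
      (Ideal.span (Set.range f)) G)
    (hdeg : ∀ p ∈ G, p.totalDegree = degX p) :
    IsGradedMonomialBasis (Ideal.span (Set.range fun i => toKx t n (f i)))
      (standardMonomials G) := by
  have h := (isGradedMonomialBasis_sumAlgEquiv hG hdeg).map_fractionRing (K := ParamField t)
  rw [Ideal.map_span, ← Set.range_comp] at h
  exact h

theorem totalDegree_toKx_le (p : ParamPoly t n) : (toKx t n p).totalDegree ≤ p.totalDegree := by
  rw [toKx_apply]
  refine le_trans ?_ (totalDegree_sumAlgEquiv_le p)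
  exact Finset.sup_mono (support_map_subset _ _)

theorem toKx_monomial_sumElim (b : Fin n →₀ ℕ) :
    toKx t n (monomial (Finsupp.sumElim b 0) 1) = monomial b 1 := by
  rw [toKx_apply, sumAlgEquiv_monomial, xPart_sumElim, yPart_sumElim, map_monomial]
  congr 1
  exact map_one _

theorem totalDegree_monomial_sumElim (b : Fin n →₀ ℕ) :
    (monomial (Finsupp.sumElim b 0) 1 : ParamPoly t n).totalDegree ≤ b.degree := by
  refine (totalDegree_monomial_le _ _).trans ?_
  have h := degree_xPart_add_degree_yPart (Finsupp.sumElim b (0 : Fin t →₀ ℕ))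
  rw [xPart_sumElim, yPart_sumElim, map_zero] at h
  exact h.ge

/-- The normal form of `q * b` has total degree at most `deg q + deg b`, and extracting its
coefficient at `b` gives back `deg b`. Thus each diagonal entry has degree at most `deg q`. -/
theorem exists_trace_eq_algebraMap
    (hG : IsReducedGroebnerBasis (elimOrder (grevlex n) (grevlex t))
      (Ideal.span (Set.range f)) G)
    (hdeg : ∀ p ∈ G, p.totalDegree = degX p) (hfin : (standardMonomials G).Finite)
    (q : ParamPoly t n) :
    ∃ P : MvPolynomial (Fin t) ℚ, P.totalDegree ≤ q.totalDegree ∧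
      algebraMap (MvPolynomial (Fin t) ℚ) (ParamField t) P
        = LinearMap.trace (ParamField t) (ParamQuotient f)
          (LinearMap.mulLeft (ParamField t)
            (Ideal.Quotient.mk (Ideal.span (Set.range fun i => toKx t n (f i))) (toKx t n q))) := by
  classical
  have := hfin.fintype
  have hS := isGradedMonomialBasis_toKx hG hdeg
  choose r hr hle hsupp using fun b : standardMonomials G =>
    exists_normalForm hG hdeg (q * monomial (Finsupp.sumElim b.1 0) 1)
  refine ⟨∑ b, coeff b.1 (sumAlgEquiv ℚ (Fin n) (Fin t) (r b)), ?_, ?_⟩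
  · refine totalDegree_finsetSum_le fun b _ => ?_
    by_cases h0 : coeff b.1 (sumAlgEquiv ℚ (Fin n) (Fin t) (r b)) = 0
    · rw [h0, totalDegree_zero]
      exact Nat.zero_le _
    · have h1 := totalDegree_coeff_sumAlgEquiv_add_le (r b) h0
      have h2 := totalDegree_mul q (monomial (Finsupp.sumElim b.1 0) 1)
      have h3 := totalDegree_monomial_sumElim (t := t) b.1
      have h4 := hle b
      omega
  · rw [LinearMap.trace_eq_matrix_trace _ hS.basis, Matrix.trace, map_sum]
    refine Finset.sum_congr rfl fun b _ => ?_
    rw [Matrix.diag_apply, LinearMap.toMatrix_apply, LinearMap.mulLeft_apply, hS.basis_apply,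
      ← map_mul, ← toKx_monomial_sumElim (t := t), ← map_mul]
    have hmem : toKx t n (q * monomial (Finsupp.sumElim b.1 0) 1) - toKx t n (r b) ∈
        Ideal.span (Set.range fun i => toKx t n (f i)) := by
      have := Ideal.mem_map_of_mem (toKx t n) (hr b)
      rw [Ideal.map_span, ← Set.range_comp, map_sub] at this
      exact this
    rw [(Ideal.Quotient.mk_eq_mk_iff_sub_mem _ _).mpr hmem, hS.basis_repr_mk, toKx_apply,
      coeff_map]
    exact fun v hv => hsupp b v (support_map_subset _ _ hv)

end ParametricBasis

/-! ### Degree of a determinant with row and column weights. -/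

theorem totalDegree_det_le {ι σ R : Type*} [Fintype ι] [DecidableEq ι] [CommRing R]
    (M : Matrix ι ι (MvPolynomial σ R)) (A : ℕ) (α β : ι → ℕ)
    (h : ∀ i j, (M i j).totalDegree ≤ A + α i + β j) :
    M.det.totalDegree ≤ ∑ i, (A + α i + β i) := by
  rw [Matrix.det_apply]
  refine totalDegree_finsetSum_le fun s _ => ?_
  have h1 : (∏ i, M (s i) i).totalDegree ≤ ∑ i, (A + α i + β i) := by
    refine (totalDegree_finsetProd _ _).trans ((Finset.sum_le_sum fun i _ => h (s i) i).trans_eq ?_)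
    simp only [Finset.sum_add_distrib]
    rw [Equiv.sum_comp s α]
  rcases Int.units_eq_one_or (Equiv.Perm.sign s) with hs | hs <;> rw [hs]
  · rwa [one_smul]
  · rwa [Units.neg_smul, one_smul, totalDegree_neg]

/-! ### Finiteness of the set of standard monomials. -/

section GenericFiniteness

open scoped TensorProduct

/-- A finite affine zero set forces any algebra generated by elements satisfying the equations to
be finite. -/
theorem finite_of_finite_zeroLocus {k T : Type*} [Field k] [IsAlgClosed k] [CommRing T]
    [Algebra k T] {n : ℕ} {I : Ideal (MvPolynomial (Fin n) k)} (hI : (zeroLocus k I).Finite)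
    (φ : MvPolynomial (Fin n) k →ₐ[k] T) (hφ : Function.Surjective φ) (hker : ∀ p ∈ I, φ p = 0) :
    Module.Finite k T := by
  have hint : ∀ i, IsIntegral k (φ (X i)) := by
    intro i
    -- `u` vanishes at the `i`-th coordinate of every zero, so by the Nullstellensatz a power of `u
    -- (X i)` lies in `I`; that power is the monic equation for `φ (X i)`.
    set u : Polynomial k := ∏ x ∈ hI.toFinset, (Polynomial.X - Polynomial.C (x i)) with hu
    have hmonic : u.Monic := Polynomial.monic_prod_of_monic _ _ fun x _ =>
      Polynomial.monic_X_sub_C _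
    have hrad : Polynomial.aeval (X i : MvPolynomial (Fin n) k) u ∈ I.radical := by
      rw [← vanishingIdeal_zeroLocus_eq_radical (K := k), mem_vanishingIdeal_iff]
      intro x hx
      rw [← Polynomial.aeval_algHom_apply, aeval_X, hu, map_prod]
      refine Finset.prod_eq_zero (hI.mem_toFinset.mpr hx) ?_
      simp
    obtain ⟨N, hN⟩ := hrad
    refine ⟨u ^ N, hmonic.pow N, ?_⟩
    have := hker _ hN
    rwa [← map_pow, ← Polynomial.aeval_algHom_apply] at this
  have htop : Algebra.adjoin k (Set.range fun i => φ (X i)) = ⊤ := by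
    have : (Set.range fun i => φ (X i)) = φ '' Set.range X := by
      rw [← Set.range_comp]
      rfl
    rw [this, ← AlgHom.map_adjoin, adjoin_range_X, Algebra.map_top]
    exact (AlgHom.range_eq_top φ).mpr hφ
  have hfg := fg_adjoin_of_finite (Set.finite_range fun i => φ (X i)) (R := k) (by
    rintro _ ⟨i, rfl⟩
    exact hint i)
  rw [htop] at hfg
  exact ⟨hfg⟩

/-- A free algebra over `R` generated by `n` elements whose base change to an algebraically closed
field `k` has finitely many points has finite bases. -/
theorem finite_of_basis_of_finite_zeroLocus {R k A ι : Type*} [CommRing R] [Field k]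
    [IsAlgClosed k] [Algebra R k] [CommRing A] [Algebra R A] (B : Module.Basis ι R A) {n : ℕ}
    (ψ : MvPolynomial (Fin n) R →ₐ[R] A) (hψ : Function.Surjective ψ)
    {I : Ideal (MvPolynomial (Fin n) R)} (hI : ∀ p ∈ I, ψ p = 0)
    (hfin : (zeroLocus k (I.map (map (algebraMap R k)))).Finite) : Finite ι := by
  let φ : MvPolynomial (Fin n) k →ₐ[k] k ⊗[R] A := aeval fun i => (1 : k) ⊗ₜ[R] ψ (X i)
  have hφmap : ∀ p, φ (map (algebraMap R k) p) = (1 : k) ⊗ₜ[R] ψ p := by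
    intro p
    induction p using MvPolynomial.induction_on with
    | C a =>
      rw [map_C, ← algebraMap_eq, ← algebraMap_eq, AlgHom.commutes, AlgHom.commutes,
        Algebra.TensorProduct.algebraMap_apply, Algebra.algebraMap_self_apply,
        Algebra.algebraMap_eq_smul_one, Algebra.algebraMap_eq_smul_one, TensorProduct.smul_tmul]
    | add p q hp hq => rw [map_add, map_add, hp, hq, map_add, TensorProduct.tmul_add]
    | mul_X p i hp =>
      have : φ (X i) = (1 : k) ⊗ₜ[R] ψ (X i) := aeval_X _ _
      rw [map_mul, map_mul, hp, map_X, map_mul, this, Algebra.TensorProduct.tmul_mul_tmul, one_mul]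
  have hφ : Function.Surjective φ := by
    intro z
    induction z using TensorProduct.induction_on with
    | zero => exact ⟨0, map_zero _⟩
    | tmul c a =>
      obtain ⟨p, rfl⟩ := hψ a
      refine ⟨c • map (algebraMap R k) p, ?_⟩
      rw [map_smul, hφmap, TensorProduct.smul_tmul', smul_eq_mul, mul_one]
    | add z w hz hw =>
      obtain ⟨p, rfl⟩ := hz
      obtain ⟨q, rfl⟩ := hw
      exact ⟨p + q, map_add _ _ _⟩
  have hker : ∀ p ∈ I.map (map (algebraMap R k)), φ p = 0 := by
    intro p hp
    have hle : I.map (map (algebraMap R k)) ≤ RingHom.ker φ := by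
      rw [Ideal.map_le_iff_le_comap]
      intro q hq
      rw [Ideal.mem_comap, RingHom.mem_ker, hφmap, hI q hq, TensorProduct.tmul_zero]
    exact hle hp
  have := finite_of_finite_zeroLocus hfin φ hφ hker
  -- Base change keeps the index set of the basis, so finite dimension over `k` bounds it.
  exact Module.Finite.finite_basis (B.baseChange k)

theorem IsGradedMonomialBasis.finite {R k : Type*} [CommRing R] [Field k] [IsAlgClosed k]
    [Algebra R k] {n : ℕ} {I : Ideal (MvPolynomial (Fin n) R)} {S : Set (Fin n →₀ ℕ)}
    (hS : IsGradedMonomialBasis I S)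
    (hfin : (zeroLocus k (I.map (map (algebraMap R k)))).Finite) : S.Finite :=
  finite_of_basis_of_finite_zeroLocus hS.basis (Ideal.Quotient.mkₐ R I)
    (Ideal.Quotient.mkₐ_surjective R I) (fun _ hp => Ideal.Quotient.eq_zero_iff_mem.mpr hp) hfin

variable {t n e : ℕ} {f : Fin e → ParamPoly t n} {G : Set (ParamPoly t n)}

theorem eval_map_sumAlgEquiv (η : Fin t → ℂ) (x : Fin n → ℂ) (p : ParamPoly t n) :
    eval x (map (aeval η : MvPolynomial (Fin t) ℚ →ₐ[ℚ] ℂ).toRingHom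
      (sumAlgEquiv ℚ (Fin n) (Fin t) p)) = aeval (Sum.elim x η) p := by
  induction p using MvPolynomial.induction_on with
  | C a => simp
  | add p q hp hq => simp only [map_add, hp, hq]
  | mul_X p i hp => rw [map_mul, map_mul, map_mul, hp, map_mul]; cases i <;> simp

theorem finite_standardMonomials
    (hG : IsReducedGroebnerBasis (elimOrder (grevlex n) (grevlex t))
      (Ideal.span (Set.range f)) G)
    (hdeg : ∀ p ∈ G, p.totalDegree = degX p) (hfin : IsGenericallyFinite f) :
    (standardMonomials G).Finite := by
  obtain ⟨O, ⟨η, hη⟩, -, hO⟩ := hfin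
  have hfib := (hO η hη).2
  set ρ : MvPolynomial (Fin t) ℚ →+* ℂ :=
    (aeval η : MvPolynomial (Fin t) ℚ →ₐ[ℚ] ℂ).toRingHom with hρ
  -- With evaluation at `η` as structure map, base change to `ℂ` is specialization of the system at
  -- `y = η`.
  let _ : Algebra (MvPolynomial (Fin t) ℚ) ℂ := ρ.toAlgebra
  refine (isGradedMonomialBasis_sumAlgEquiv hG hdeg).finite (k := ℂ)
    (hfib.subset fun x hx i => ?_)
  rw [← eval_map_sumAlgEquiv, ← aeval_eq_eval]
  exact hx _ (Ideal.mem_map_of_mem _ (Ideal.subset_span ⟨i, rfl⟩))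

end GenericFiniteness

/-! ### The degree bound for minors. -/

theorem mainTheorem6 {t n e : ℕ} (f : Fin e → ParamPoly t n)
    (hfin : IsGenericallyFinite f)
    (hreg : IsAffineRegularSeq fun i => toKx t n (f i))
    (G : Set (ParamPoly t n))
    (hG : IsReducedGroebnerBasis (elimOrder (grevlex n) (grevlex t))
      (Ideal.span (Set.range f)) G)
    (hdeg : ∀ p ∈ G, p.totalDegree = degX p)
    (d : ℕ) (hd : d = Finset.univ.sup fun i => (f i).totalDegree)
    (g : ParamPoly t n) (k : ℕ) (r c : Fin k ↪ standardMonomials G) :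
    ∃ P : MvPolynomial (Fin t) ℚ,
      algebraMap (MvPolynomial (Fin t) ℚ) (ParamField t) P
        = ((hermiteMatrix f G g).submatrix r c).det ∧
      (P.totalDegree : ℤ) ≤ ((g.totalDegree : ℤ) + n * ((d : ℤ) - 1)) * (d : ℤ) ^ n := by
  have hfinS := finite_standardMonomials hG hdeg hfin
  have := hfinS.fintype
  have hbound := sum_le_of_sum_X_pow_mul (fun b : standardMonomials G => b.1.degree) hreg.1 _
    ((isGradedMonomialBasis_toKx hG hdeg).sum_X_pow_mul hreg) (d := d)
    (fun i => (totalDegree_toKx_le (f i)).trans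
      (hd ▸ Finset.le_sup (f := fun i => (f i).totalDegree) (Finset.mem_univ i))) g.totalDegree
  choose P hPdeg hP using fun b b' : standardMonomials G =>
    exists_trace_eq_algebraMap hG hdeg hfinS
      (g * monomial (Finsupp.sumElim b.1 0) 1 * monomial (Finsupp.sumElim b'.1 0) 1)
  refine ⟨(Matrix.of fun i j => P (r i) (c j)).det, ?_, ?_⟩
  · rw [RingHom.map_det]
    congr 1
    ext i j
    simp only [RingHom.mapMatrix_apply, Matrix.map_apply, Matrix.of_apply, Matrix.submatrix_apply,
      hermiteMatrix, hP, map_mul, toKx_monomial_sumElim]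
  · refine le_trans ?_ hbound
    have h1 := totalDegree_det_le (Matrix.of fun i j => P (r i) (c j)) g.totalDegree
      (fun i => (r i).1.degree) (fun i => (c i).1.degree) fun i j => by
        have h2 := totalDegree_mul
          (g * monomial (Finsupp.sumElim (r i).1 0) 1) (monomial (Finsupp.sumElim (c j).1 0) 1)
        have h3 := totalDegree_mul g (monomial (Finsupp.sumElim (r i).1 0) 1)
        have h4 := totalDegree_monomial_sumElim (t := t) (r i).1
        have h5 := totalDegree_monomial_sumElim (t := t) (c j).1
        have h6 := hPdeg (r i) (c j)
        rw [Matrix.of_apply]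
        omega
    -- The chosen rows, and likewise the columns, are distinct and weights are nonnegative, so each
    -- partial sum is at most the sum over all standard monomials.
    have hsum : ∀ (s : Fin k ↪ standardMonomials G) (w : standardMonomials G → ℕ),
        ∑ i, w (s i) ≤ ∑ b, w b := fun s w => by
      rw [← Finset.sum_map Finset.univ s w]
      exact Finset.sum_le_sum_of_subset (Finset.subset_univ _)
    -- The summand `deg g` is charged to the rows only, matching its single occurrence in each entry
    -- bound.
    have h2 := hsum r fun b => g.totalDegree + b.1.degree
    have h3 := hsum c fun b => b.1.degree
    have h4 : ∑ b : standardMonomials G, ((g.totalDegree : ℤ) + 2 * b.1.degree)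
        = ((∑ b : standardMonomials G, (g.totalDegree + b.1.degree)
          + ∑ b : standardMonomials G, b.1.degree : ℕ) : ℤ) := by
      rw [← Finset.sum_add_distrib]
      push_cast
      exact Finset.sum_congr rfl fun b _ => by ring
    rw [h4]
    rw [Finset.sum_add_distrib] at h1
    exact_mod_cast h1.trans (add_le_add h2 h3)
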